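/- Let $D\subset\mathbb{R}^d$ be a non-empty connected open set. For $x\in\partial D$ and $r>0$ let $\mathcal{N}_{x,r}=\{\mathbf{n}\in\mathbb{R}^d : |\mathbf{n}|=1,\ B(x-r\mathbf{n},r)\cap D=\emptyset\}$, where $B(z,r)$ is the open ball, and let $\mathcal{N}_x=\bigcup_{r>0}\mathcal{N}_{x,r}$. Assume: (A) there is $r_0>0$ such that $\mathcal{N}_x=\mathcal{N}_{x,r_0}\neq\emptyset$ for every $x\in\partial D$; (B) there are $\delta>0$ and $\beta\ge 1$ such that for every $x\in\partial D$ there is a unit vector $l_x$ with $(l_x,\mathbf{n})\ge 1/\beta$ for all $\mathbf{n}\in\bigcup_{y\in B(x,\delta)\cap\partial D}\mathcal{N}_y$. Let $\sigma:\mathbb{R}^d\to L(\mathbb{R}^n,\mathbb{R}^d)$ and $b:\mathbb{R}^d\to\mathbb{R}^d$ be bounded and globally Lipschitz (for instance $\sigma\in C^2_b$, $b\in C^1_b$), let $T\ge 0$, let $w:[0,T]\to\mathbb{R}^n$ be continuous and of bounded variation, and let $x_0\in\bar D$. Then there is a unique pair $(x,\Phi)$ of paths $[0,T]\to\mathbb{R}^d$,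 with $x$ continuous and of bounded variation, which solves the reflecting ODE $$x(t)=x_0+\int_0^t\sigma(x(s))\,dw(s)+\int_0^t b(x(s))\,ds+\Phi(t),\qquad 0\le t\le T,$$ that is, for which $(x,\Phi)$ solves the Skorohod problem on $D$ associated with the path $y(t)=x_0+\int_0^t\sigma(x(s))\,dw(s)+\int_0^t b(x(s))\,ds$ (Lebesgue–Stieltjes integrals). Here $(\xi,\phi)$ solves the Skorohod problem associated with $y$ if: $\xi$ is a continuous path in $\bar D$ with $\xi(0)=y(0)$; $\xi(t)=y(t)+\phi(t)$ for $0\le t\le T$; $\phi$ is a continuous path of bounded variation with $\phi(0)=0$; and, writing $\|\phi\|_{[0,t]}$ for the total variation of $\phi$ on $[0,t]$, for all $0\le t\le T$ $$\phi(t)=\int_0^t\mathbf{n}(s)\,d\|\phi\|_{[0,s]},\qquad \|\phi\|_{[0,t]}=\int_0^t 1_{\partial D}(\xi(s))\,d\|\phi\|_{[0,s]},$$ for some $d\|\phi\|$-measurable $\mathbf{n}$ with $\mathbf{n}(s)\in\mathcal{N}_{\xi(s)}$ whenever $\xi(s)\in\partial D$. -/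

import Mathlib

open MeasureTheory Set
open scoped NNReal

namespace ReflectingODE

noncomputable section

/-! ### The domain: inward unit normals and the two geometric conditions -/

section Domain

variable {E : Type*} [NormedAddCommGroup E] [InnerProductSpace ℝ E]

/-- `N_{x,r}`: the unit vectors `n` such that the open ball `B(x - r n, r)` misses `D`. -/
def normalsOfRadius (D : Set E) (x : E) (r : ℝ) : Set E :=
  {n | ‖n‖ = 1 ∧ Metric.ball (x - r • n) r ∩ D = ∅}

/-- `N_x`: the inward unit normal vectors at `x`, the union of the `N_{x,r}` over `r > 0`. -/
def normals (D : Set E) (x : E) : Set E :=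
  {n | ∃ r : ℝ, 0 < r ∧ n ∈ normalsOfRadius D x r}

/-- Condition (A), the uniform exterior sphere condition. -/
def ConditionA (D : Set E) : Prop :=
  ∃ r₀ : ℝ, 0 < r₀ ∧ ∀ x ∈ frontier D,
    normals D x = normalsOfRadius D x r₀ ∧ (normals D x).Nonempty

/-- Condition (B). -/
def ConditionB (D : Set E) : Prop :=
  ∃ δ β : ℝ, 0 < δ ∧ 1 ≤ β ∧ ∀ x ∈ frontier D, ∃ l : E, ‖l‖ = 1 ∧
    ∀ y ∈ Metric.ball x δ ∩ frontier D, ∀ n ∈ normals D y, 1 / β ≤ inner ℝ l n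

end Domain

/-! ### Paths of bounded variation on `[0, T]`

A path on `[0, T]` is a function on `ℝ` of which only the values on `Icc 0 T` matter. -/

section Paths

variable {E : Type*} [NormedAddCommGroup E]

/-- The total variation `‖φ‖_{[0,t]}`, frozen after time `T` (and zero for `t < 0`). -/
def totalVar (T : ℝ) (φ : ℝ → E) (t : ℝ) : ℝ :=
  (eVariationOn φ (Icc 0 (min t T))).toReal

theorem totalVar_mono {T : ℝ} {φ : ℝ → E} (hφ : BoundedVariationOn φ (Icc 0 T)) :
    Monotone (totalVar T φ) := by
  intro s t hst
  refine ENNReal.toReal_mono ?_ ?_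
  · exact hφ.mono (Icc_subset_Icc_right (min_le_right _ _))
  · exact eVariationOn.mono φ (Icc_subset_Icc_right (min_le_min_right _ hst))

/-- The Lebesgue–Stieltjes measure `d‖φ‖_{[0,s]}` on `ℝ`; it is carried by `[0, T]`. -/
def totalVarMeasure {T : ℝ} {φ : ℝ → E} (hφ : BoundedVariationOn φ (Icc 0 T)) : Measure ℝ :=
  (totalVar_mono hφ).stieltjesFunction.measure

/-- The path on `ℝ` that agrees with `w` on `[0, T]` and is constant on either side of it. -/
def clamp (T : ℝ) (w : ℝ → E) : ℝ → E := fun t => w (max 0 (min t T))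

theorem clamp_boundedVariationOn {T : ℝ} {w : ℝ → E} (hw : BoundedVariationOn w (Icc 0 T)) :
    BoundedVariationOn (clamp T w) univ := by
  rcases le_total 0 T with hT | hT
  · refine ne_top_of_le_ne_top hw
      (eVariationOn.comp_le_of_monotoneOn w (fun t : ℝ => max 0 (min t T)) ?_ ?_)
    · exact fun a _ b _ h => max_le_max le_rfl (min_le_min_right _ h)
    · exact fun t _ => ⟨le_max_left _ _, max_le hT (min_le_right _ _)⟩
  · have h : eVariationOn (clamp T w) univ = 0 := by
      refine eVariationOn.constant_on ?_
      rintro _ ⟨s, -, rfl⟩ _ ⟨t, -, rfl⟩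
      simp [clamp, max_eq_left ((min_le_right _ _).trans hT)]
    simp [BoundedVariationOn, h]

/-- The vector-valued Lebesgue–Stieltjes measure `dw` of a path `w` of bounded variation on
`[0, T]`. -/
def pathMeasure [CompleteSpace E] {T : ℝ} {w : ℝ → E} (hw : BoundedVariationOn w (Icc 0 T)) :
    VectorMeasure ℝ E :=
  (clamp_boundedVariationOn hw).vectorMeasure

end Paths

/-! ### The Skorohod problem and the reflecting ODE -/

/-- `(ξ, φ)` solves the Skorohod problem on `[0, T]` for the domain `D` and the path `y`. -/
structure IsSkorohodSolution {E : Type*} [NormedAddCommGroup E] [InnerProductSpace ℝ E]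
    (D : Set E) (T : ℝ) (y ξ φ : ℝ → E) : Prop where
  continuousOn_path : ContinuousOn ξ (Icc 0 T)
  mem_closure : ∀ t ∈ Icc 0 T, ξ t ∈ closure D
  initial : ξ 0 = y 0
  decomposition : ∀ t ∈ Icc 0 T, ξ t = y t + φ t
  continuousOn_reflection : ContinuousOn φ (Icc 0 T)
  reflection_zero : φ 0 = 0
  boundedVariation : BoundedVariationOn φ (Icc 0 T)
  reflection_eq : ∃ n : ℝ → E,
    (∀ s ∈ Icc 0 T, ξ s ∈ frontier D → n s ∈ normals D (ξ s)) ∧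
    AEStronglyMeasurable n ((totalVarMeasure boundedVariation).restrict (Ioc 0 T)) ∧
    ∀ t ∈ Icc 0 T, φ t = ∫ s in Ioc 0 t, n s ∂(totalVarMeasure boundedVariation)
  variation_eq : ∀ t ∈ Icc 0 T, totalVar T φ t =
    ∫ s in Ioc 0 t, (frontier D).indicator (fun _ => (1 : ℝ)) (ξ s)
      ∂(totalVarMeasure boundedVariation)

/-- The path `t ↦ x₀ + ∫₀ᵗ σ(x(s)) dw(s) + ∫₀ᵗ b(x(s)) ds`. -/
def drivenPath {E F : Type*} [NormedAddCommGroup E] [NormedSpace ℝ E]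
    [NormedAddCommGroup F] [NormedSpace ℝ F] [CompleteSpace F]
    (σ : E → F →L[ℝ] E) (b : E → E) {T : ℝ} {w : ℝ → F} (hw : BoundedVariationOn w (Icc 0 T))
    (x₀ : E) (x : ℝ → E) (t : ℝ) : E :=
  x₀ + (∫ᵛ s in Ioc 0 t, σ (x s) ∂[ContinuousLinearMap.id ℝ (F →L[ℝ] E); pathMeasure hw])
    + ∫ s in (0 : ℝ)..t, b (x s)

/-- `(x, Φ)` is a solution of the reflecting ODE
`x(t) = x₀ + ∫₀ᵗ σ(x(s)) dw(s) + ∫₀ᵗ b(x(s)) ds + Φ(t)` on `[0, T]`: `x` is a continuous path of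
bounded variation and `(x, Φ)` solves the Skorohod problem for the path `drivenPath`. -/
structure IsSolution {E F : Type*} [NormedAddCommGroup E] [InnerProductSpace ℝ E]
    [NormedAddCommGroup F] [NormedSpace ℝ F] [CompleteSpace F]
    (D : Set E) (σ : E → F →L[ℝ] E) (b : E → E) {T : ℝ} {w : ℝ → F}
    (hw : BoundedVariationOn w (Icc 0 T)) (x₀ : E) (x Φ : ℝ → E) : Prop where
  continuousOn : ContinuousOn x (Icc 0 T)
  boundedVariationOn : BoundedVariationOn x (Icc 0 T)
  skorohod : IsSkorohodSolution D T (drivenPath σ b hw x₀ x) x Φ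

end

end ReflectingODE

/-! A normal of radius `r` is a unit vector `n` with `(z - x, n) + |z - x|² / (2 r) ≥ 0` for `z` in
`D` (`mem_normalsOfRadius_iff`). Integrating this proximal inequality against `d‖φ‖`, and freezing
the coefficients of the equation at the left endpoint, describes a solution by inequalities between
increments: this is `IsIncrementSolution`. Its errors are of second order in a continuous monotone
control `G`, except for the curvature term `|z - x|² (G t - G s)`. No integral and no normal field
occurs in it, so it can be verified on a discrete scheme and survives pointwise limits.

Uniqueness: test the variational inequality of each of two solutions with the other path. Over `[s,
t]` the squared distance then grows by at most a constant times `|x s - x' s|² (G t - G s)`, up to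
`O((G t - G s)²)` (`IsIncrementSolution.norm_sub_sq_sub_le`). Second-order errors disappear under
refinement because `G` is continuous, and Gronwall (`le_exp_mul_of_increment_le`) gives equality.
Any solution fits this frame once its own reflection is added to the control
(`IsSolution.isIncrementSolution`).

Existence: in the projected Euler scheme each step moves with frozen coefficients and then takes a
nearest point `q` of the closure to the point `p` reached. The uniform radius `r₀` gives the
proximal inequality with constant `|q - p| / (2 r₀)`, which is of the size of the step, so the
estimates do not depend on the mesh (`exists_euler_scheme`). An ultrafilter limit is an increment
solution controlled by the driver alone (`exists_isIncrementSolution`).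

Return to the integral equation (`IsIncrementSolution.isSolution`): the defect in the equation has
quadratically small increments, hence is constant. Differentiating `φ` with respect to `d‖φ‖` gives
a unit density `n` (`exists_polar_density`). Dividing the variational inequality by the mass of
shrinking intervals yields a proximal inequality for `n` at `x s`, which shows both that `x s` is on
the frontier and that `n` is a normal there. -/

namespace ReflectingODE

/-! ### Gronwall's inequality for increments -/

section Increments

open Filter Topology

/-- A discrete Gronwall inequality with a quadratic error. -/
theorem le_exp_mul_of_step_le {K C ε : ℝ} (hK : 0 ≤ K) (hC : 0 ≤ C) (hε : 0 ≤ ε) {f g : ℕ → ℝ}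
    (hf₀ : ∀ j, 0 ≤ f j) {m : ℕ} (hg : ∀ j < m, g j ≤ g (j + 1))
    (hgε : ∀ j < m, g (j + 1) - g j ≤ ε)
    (hf : ∀ j < m, f (j + 1) - f j ≤ K * f j * (g (j + 1) - g j) + C * (g (j + 1) - g j) ^ 2) :
    f m ≤ Real.exp (K * (g m - g 0)) * (f 0 + C * ε * (g m - g 0)) := by
  suffices h : ∀ j ≤ m, 0 ≤ g j - g 0 ∧
      f j ≤ Real.exp (K * (g j - g 0)) * (f 0 + C * ε * (g j - g 0)) from (h m le_rfl).2
  intro j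
  induction j with
  | zero => intro _; simp
  | succ j ih =>
    intro hj
    obtain ⟨h0, h1⟩ := ih (by omega)
    have hd : 0 ≤ g (j + 1) - g j := sub_nonneg.2 (hg j (by omega))
    have hdε := hgε j (by omega)
    have hs := hf j (by omega)
    set d := g (j + 1) - g j with hd_def
    have hsplit : g (j + 1) - g 0 = (g j - g 0) + d := by rw [hd_def]; ring
    refine ⟨by linarith, ?_⟩
    have he : 1 + K * d ≤ Real.exp (K * d) := by
      have := Real.add_one_le_exp (K * d); linarith
    have h2 : f (j + 1) ≤ Real.exp (K * d) * f j + C * ε * d := by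
      have h3 : (1 + K * d) * f j ≤ Real.exp (K * d) * f j :=
        mul_le_mul_of_nonneg_right he (hf₀ j)
      -- Trading one factor `d` for `ε` makes the accumulated error linear in the total increment,
      -- with a coefficient that vanishes with the mesh.
      have h4 : C * d ^ 2 ≤ C * ε * d := by
        have := mul_le_mul_of_nonneg_left (mul_le_mul_of_nonneg_right hdε hd) hC
        nlinarith
      nlinarith
    have h5 : 1 ≤ Real.exp (K * (g j - g 0 + d)) := Real.one_le_exp (by positivity)
    rw [hsplit]
    have h6 : Real.exp (K * d) * f j ≤
        Real.exp (K * (g j - g 0 + d)) * (f 0 + C * ε * (g j - g 0)) := by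
      have : Real.exp (K * (g j - g 0 + d)) = Real.exp (K * d) * Real.exp (K * (g j - g 0)) := by
        rw [← Real.exp_add]; ring_nf
      rw [this, mul_assoc]
      exact mul_le_mul_of_nonneg_left h1 (Real.exp_nonneg _)
    have h7 : C * ε * d ≤ Real.exp (K * (g j - g 0 + d)) * (C * ε * d) :=
      le_mul_of_one_le_left (by positivity) h5
    calc f (j + 1) ≤ _ := h2
      _ ≤ _ := add_le_add h6 h7
      _ = _ := by ring

/-- A continuous function has small increments along fine enough uniform partitions. -/
theorem exists_uniform_partition_sub_le {G : ℝ → ℝ} {a b ε : ℝ} (hab : a ≤ b)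
    (hG : ContinuousOn G (Icc a b)) (hε : 0 < ε) :
    ∃ m : ℕ, ∃ u : ℕ → ℝ, u 0 = a ∧ u m = b ∧ (∀ j < m, u j ≤ u (j + 1)) ∧
      (∀ j ≤ m, u j ∈ Icc a b) ∧ ∀ j < m, G (u (j + 1)) - G (u j) ≤ ε := by
  have huc := isCompact_Icc.uniformContinuousOn_of_continuous hG
  obtain ⟨δ, hδ, h⟩ := Metric.uniformContinuousOn_iff.1 huc ε hε
  obtain ⟨m, hm⟩ := exists_nat_gt ((b - a) / δ)
  have hm0 : (0 : ℝ) ≤ (b - a) / δ := div_nonneg (by linarith) hδ.le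
  have hmpos : (0 : ℝ) < m := hm0.trans_lt hm
  have hstep : (b - a) / m < δ := by
    rw [div_lt_iff₀ hmpos]; rw [div_lt_iff₀ hδ] at hm; linarith
  have hstep0 : 0 ≤ (b - a) / m := div_nonneg (by linarith) hmpos.le
  have hmem : ∀ j ≤ m, a + j * ((b - a) / m) ∈ Icc a b := by
    intro j hj
    have hjm : (j : ℝ) ≤ m := by exact_mod_cast hj
    refine ⟨by nlinarith [(Nat.cast_nonneg j : (0 : ℝ) ≤ j)], ?_⟩
    have : (j : ℝ) * ((b - a) / m) ≤ m * ((b - a) / m) := mul_le_mul_of_nonneg_right hjm hstep0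
    rw [mul_div_cancel₀ _ hmpos.ne'] at this
    linarith
  refine ⟨m, fun j => a + j * ((b - a) / m), by simp, ?_, ?_, hmem, ?_⟩
  · change a + (m : ℝ) * ((b - a) / m) = b
    rw [mul_div_cancel₀ _ hmpos.ne']; ring
  · intro j _
    push_cast
    linarith
  · intro j hj
    have := h _ (hmem (j + 1) hj) _ (hmem j hj.le) (by
      rw [Real.dist_eq]; push_cast
      rw [show a + ((j : ℝ) + 1) * ((b - a) / m) - (a + j * ((b - a) / m)) = (b - a) / m by ring,
        abs_of_nonneg hstep0]
      exact hstep)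
    rw [Real.dist_eq] at this
    exact (le_abs_self _).trans this.le

/-- **Gronwall's inequality for increments**, with respect to a continuous control `G`. -/
theorem le_exp_mul_of_increment_le {K C a b : ℝ} (hab : a ≤ b) (hK : 0 ≤ K) (hC : 0 ≤ C)
    {f G : ℝ → ℝ} (hG : ContinuousOn G (Icc a b)) (hGm : MonotoneOn G (Icc a b))
    (hf₀ : ∀ t, 0 ≤ f t)
    (hf : ∀ s ∈ Icc a b, ∀ t ∈ Icc a b, s ≤ t →
      f t - f s ≤ K * f s * (G t - G s) + C * (G t - G s) ^ 2) :
    f b ≤ Real.exp (K * (G b - G a)) * f a := by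
  have key : ∀ ε > 0, f b ≤ Real.exp (K * (G b - G a)) * (f a + C * ε * (G b - G a)) := by
    intro ε hε
    obtain ⟨m, u, hu0, hum, humono, hmem, hstep⟩ := exists_uniform_partition_sub_le hab hG hε
    have := le_exp_mul_of_step_le (f := fun j => f (u j)) (g := fun j => G (u j)) (m := m)
      hK hC hε.le (fun j => hf₀ _)
      (fun j hj => hGm (hmem j hj.le) (hmem (j + 1) hj) (humono j hj)) hstep
      (fun j hj => hf _ (hmem j hj.le) _ (hmem (j + 1) hj) (humono j hj))
    simpa only [hu0, hum] using this
  have hlim : Tendsto (fun ε : ℝ => Real.exp (K * (G b - G a)) * (f a + C * ε * (G b - G a)))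
      (𝓝[>] 0) (𝓝 (Real.exp (K * (G b - G a)) * (f a + C * 0 * (G b - G a)))) := by
    refine Tendsto.mono_left (Continuous.tendsto ?_ 0) nhdsWithin_le_nhds
    fun_prop
  have := ge_of_tendsto hlim (eventually_mem_nhdsWithin.mono key)
  simpa using this

/-- A path whose increments are quadratically small with respect to a continuous control is
constant. -/
theorem eq_of_norm_sub_le_sq {E : Type*} [NormedAddCommGroup E] {C a b : ℝ} (hab : a ≤ b)
    (hC : 0 ≤ C) {R : ℝ → E} {G : ℝ → ℝ} (hG : ContinuousOn G (Icc a b))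
    (hGm : MonotoneOn G (Icc a b))
    (hR : ∀ s ∈ Icc a b, ∀ t ∈ Icc a b, s ≤ t → ‖R t - R s‖ ≤ C * (G t - G s) ^ 2) :
    R b = R a := by
  -- With `K = 0` there is no growth, and `‖R t - R a‖` starts from zero.
  have := le_exp_mul_of_increment_le (K := 0) (f := fun t => ‖R t - R a‖) hab le_rfl hC hG hGm
    (fun t => norm_nonneg _) (fun s hs t ht hst => by
      have h1 := hR s hs t ht hst
      have h2 : ‖R t - R a‖ - ‖R s - R a‖ ≤ ‖R t - R s‖ := by
        have := norm_sub_norm_le (R t - R a) (R s - R a)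
        rwa [sub_sub_sub_cancel_right] at this
      linarith)
  simp only [sub_self, norm_zero, mul_zero] at this
  exact sub_eq_zero.1 (norm_le_zero_iff.1 this)

end Increments

/-! ### Proximal normals and nearest points -/

section Geometry

variable {E : Type*} [NormedAddCommGroup E] [InnerProductSpace ℝ E] {D : Set E}

theorem norm_sub_sub_smul_sq {x z n : E} {r : ℝ} (hn : ‖n‖ = 1) (hr : 0 < r) :
    ‖z - (x - r • n)‖ ^ 2 = r ^ 2 + 2 * r * (inner ℝ (z - x) n + ‖z - x‖ ^ 2 / (2 * r)) := by
  rw [show z - (x - r • n) = (z - x) + r • n by abel, norm_add_sq_real, inner_smul_right,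
    norm_smul, hn, Real.norm_eq_abs, mul_one, sq_abs]
  field_simp
  ring

/-- Squaring `|z - (x - r n)| ≥ r`, cancelling `r²` and dividing by `2 r` makes the exterior ball
condition affine in `n`, a form that can be integrated and passed to limits. -/
theorem mem_normalsOfRadius_iff {x n : E} {r : ℝ} (hr : 0 < r) :
    n ∈ normalsOfRadius D x r ↔
      ‖n‖ = 1 ∧ ∀ z ∈ D, 0 ≤ inner ℝ (z - x) n + ‖z - x‖ ^ 2 / (2 * r) := by
  refine and_congr_right fun hn => ?_
  have key : ∀ z, z ∉ Metric.ball (x - r • n) r ↔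
      0 ≤ inner ℝ (z - x) n + ‖z - x‖ ^ 2 / (2 * r) := by
    intro z
    rw [Metric.mem_ball, not_lt, dist_eq_norm, ← abs_of_pos hr, ← abs_norm (z - _), ← sq_le_sq,
      abs_of_pos hr, norm_sub_sub_smul_sq hn hr, le_add_iff_nonneg_right]
    exact mul_nonneg_iff_of_pos_left (by positivity)
  constructor
  · intro h z hz
    exact (key z).1 fun hz' => (h.le ⟨hz', hz⟩ : z ∈ (∅ : Set E))
  · intro h
    refine eq_empty_of_forall_notMem fun z hz => (key z).2 (h z hz.2) hz.1

theorem inner_add_nonneg_of_mem_normalsOfRadius {x n z : E} {r : ℝ} (hr : 0 < r)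
    (hn : n ∈ normalsOfRadius D x r) (hz : z ∈ closure D) :
    0 ≤ inner ℝ (z - x) n + ‖z - x‖ ^ 2 / (2 * r) := by
  have hcl : IsClosed {z : E | 0 ≤ inner ℝ (z - x) n + ‖z - x‖ ^ 2 / (2 * r)} :=
    isClosed_le continuous_const (by fun_prop)
  exact closure_minimal ((mem_normalsOfRadius_iff hr).1 hn).2 hcl hz

/-- A point of `closure D` at which a proximal inequality with a unit vector holds is on the
frontier. -/
theorem mem_frontier_of_inner_add_nonneg {x n : E} {c : ℝ} (hD : IsOpen D) (hx : x ∈ closure D)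
    (hn : ‖n‖ = 1) (h : ∀ z ∈ D, 0 ≤ inner ℝ (z - x) n + c * ‖z - x‖ ^ 2) : x ∈ frontier D := by
  rw [hD.frontier_eq]
  refine ⟨hx, fun hxD => ?_⟩
  -- For `x` in the open set `D`, the choice `z = x - ε • n` would give `0 ≤ -ε + c ε²`, which fails
  -- once `c ε < 1`.
  have hev : ∀ᶠ ε : ℝ in nhdsWithin 0 (Ioi 0), x - ε • n ∈ D := by
    have : Filter.Tendsto (fun ε : ℝ => x - ε • n) (nhdsWithin 0 (Ioi 0)) (nhds x) := by
      have h0 : Continuous fun ε : ℝ => x - ε • n := by fun_prop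
      simpa using (h0.tendsto 0).mono_left nhdsWithin_le_nhds
    exact this (hD.mem_nhds hxD)
  have hev2 : ∀ᶠ ε : ℝ in nhdsWithin 0 (Ioi 0), c * ε < 1 := by
    have : Filter.Tendsto (fun ε : ℝ => c * ε) (nhdsWithin 0 (Ioi 0)) (nhds 0) := by
      have h0 : Continuous fun ε : ℝ => c * ε := by fun_prop
      simpa using (h0.tendsto 0).mono_left nhdsWithin_le_nhds
    exact this.eventually_lt_const one_pos
  obtain ⟨ε, ⟨h1, h2⟩, h3⟩ := ((hev.and hev2).and self_mem_nhdsWithin).exists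
  have hε : 0 < ε := h3
  have h4 := h _ h1
  rw [sub_sub_cancel_left, inner_neg_left, inner_smul_left, real_inner_self_eq_norm_sq, norm_neg,
    norm_smul, hn, Real.norm_eq_abs, abs_of_pos hε] at h4
  simp only [conj_trivial] at h4
  nlinarith

/-- Under the uniform exterior sphere condition, a nearest point `q` of `p` satisfies the proximal
inequality with a uniform constant. -/
theorem neg_le_inner_of_nearest {r₀ : ℝ} (hr₀ : 0 < r₀) (hD : IsOpen D)
    (hA : ∀ x ∈ frontier D, normals D x = normalsOfRadius D x r₀) {p q : E}
    (hq : q ∈ closure D) (hpq : ∀ z ∈ closure D, ‖q - p‖ ≤ ‖z - p‖) {z : E} (hz : z ∈ closure D) :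
    -(‖q - p‖ / (2 * r₀) * ‖z - q‖ ^ 2) ≤ inner ℝ (z - q) (q - p) := by
  rcases eq_or_ne q p with rfl | hne
  · simp
  have hpos : 0 < ‖q - p‖ := norm_pos_iff.2 (sub_ne_zero.2 hne)
  set n : E := ‖q - p‖⁻¹ • (q - p) with hn_def
  have hn : ‖n‖ = 1 := by rw [hn_def, norm_smul, norm_inv, norm_norm, inv_mul_cancel₀ hpos.ne']
  have hqp : ‖q - p‖ • n = q - p := by rw [hn_def, smul_inv_smul₀ hpos.ne']
  have hmem : n ∈ normalsOfRadius D q ‖q - p‖ := by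
    refine ⟨hn, ?_⟩
    rw [hqp, sub_sub_cancel]
    refine eq_empty_of_forall_notMem fun z' hz' => ?_
    have h1 := hpq z' (subset_closure hz'.2)
    have h2 : ‖z' - p‖ < ‖q - p‖ := mem_ball_iff_norm.1 hz'.1
    linarith
  have hfr : q ∈ frontier D := by
    refine mem_frontier_of_inner_add_nonneg (n := n) (c := 1 / (2 * ‖q - p‖)) hD hq hn
      fun z' hz' => ?_
    have := ((mem_normalsOfRadius_iff hpos).1 hmem).2 z' hz'
    rwa [div_mul_eq_mul_div, one_mul]
  -- The ball about `p` only gives the radius `‖q - p‖`, which may be tiny; the uniform condition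
  -- upgrades it to `r₀`.
  have hmem' : n ∈ normalsOfRadius D q r₀ := hA q hfr ▸ ⟨_, hpos, hmem⟩
  have h := inner_add_nonneg_of_mem_normalsOfRadius hr₀ hmem' hz
  have h' := mul_nonneg hpos.le h
  rw [mul_add, ← real_inner_smul_right, hqp] at h'
  have : ‖q - p‖ * (‖z - q‖ ^ 2 / (2 * r₀)) = ‖q - p‖ / (2 * r₀) * ‖z - q‖ ^ 2 := by ring
  linarith

end Geometry

/-! ### Solutions in terms of increments -/

section IncrementSolutions

variable {ι E F : Type*} [Preorder ι] [NormedAddCommGroup E] [InnerProductSpace ℝ E]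
  [NormedAddCommGroup F] [NormedSpace ℝ F]

/-- `(x, φ)` solves the reflecting equation up to errors quadratic in the control `G`: a
description of the solutions by increments only. The time of the index `t` is `τ t`. -/
structure IsIncrementSolution (D : Set E) (σ : E → F →L[ℝ] E) (b : E → E) (S : Set ι)
    (w : ι → F) (τ G : ι → ℝ) (C : ℝ) (x φ : ι → E) : Prop where
  mem_closure : ∀ t ∈ S, x t ∈ closure D
  path_le : ∀ s ∈ S, ∀ t ∈ S, s ≤ t → ‖x t - x s‖ ≤ C * (G t - G s)
  reflection_le : ∀ s ∈ S, ∀ t ∈ S, s ≤ t → ‖φ t - φ s‖ ≤ C * (G t - G s)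
  equation : ∀ s ∈ S, ∀ t ∈ S, s ≤ t →
    ‖x t - x s - σ (x s) (w t - w s) - (τ t - τ s) • b (x s) - (φ t - φ s)‖ ≤
      C * (G t - G s) ^ 2
  variational : ∀ s ∈ S, ∀ t ∈ S, s ≤ t → ∀ z ∈ closure D,
    -(C * (‖z - x s‖ ^ 2 + (1 + ‖z - x s‖ + (G t - G s)) * (G t - G s)) * (G t - G s)) ≤
      inner ℝ (z - x s) (φ t - φ s)

variable {D : Set E} {σ : E → F →L[ℝ] E} {b : E → E} {S : Set ι} {w : ι → F} {τ G G' : ι → ℝ}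
  {C C' : ℝ} {x x' φ φ' : ι → E}

/-- Needed to put two solutions with different controls and constants on a common footing. -/
theorem IsIncrementSolution.mono_control (h : IsIncrementSolution D σ b S w τ G C x φ)
    (hC : 0 ≤ C) (hCC' : C ≤ C') (hG : ∀ s ∈ S, ∀ t ∈ S, s ≤ t → 0 ≤ G t - G s)
    (hGG' : ∀ s ∈ S, ∀ t ∈ S, s ≤ t → G t - G s ≤ G' t - G' s) :
    IsIncrementSolution D σ b S w τ G' C' x φ where
  mem_closure := h.mem_closure
  path_le s hs t ht hst := (h.path_le s hs t ht hst).trans <|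
    mul_le_mul hCC' (hGG' s hs t ht hst) (hG s hs t ht hst) (hC.trans hCC')
  reflection_le s hs t ht hst := (h.reflection_le s hs t ht hst).trans <|
    mul_le_mul hCC' (hGG' s hs t ht hst) (hG s hs t ht hst) (hC.trans hCC')
  equation s hs t ht hst := (h.equation s hs t ht hst).trans <| by
    have := hG s hs t ht hst
    have := hGG' s hs t ht hst
    have : 0 ≤ C' := hC.trans hCC'
    gcongr
  variational s hs t ht hst z hz := by
    refine le_trans (neg_le_neg ?_) (h.variational s hs t ht hst z hz)
    have h1 := hG s hs t ht hst
    have h2 := hGG' s hs t ht hst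
    have h3 : 0 ≤ C' := hC.trans hCC'
    have h4 : 0 ≤ G' t - G' s := h1.trans h2
    gcongr

/-- Reindexing turns a scheme on `ℕ` into step functions of real time, and also restricts from `[0,
∞)` to `[0, T]`. -/
theorem IsIncrementSolution.comp {κ : Type*} [Preorder κ]
    (h : IsIncrementSolution D σ b S w τ G C x φ) {u : κ → ι} (hu : Monotone u) {S' : Set κ}
    (hS : MapsTo u S' S) :
    IsIncrementSolution D σ b S' (w ∘ u) (τ ∘ u) (G ∘ u) C (x ∘ u) (φ ∘ u) where
  mem_closure _ ht := h.mem_closure _ (hS ht)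
  path_le _ hs _ ht hst := h.path_le _ (hS hs) _ (hS ht) (hu hst)
  reflection_le _ hs _ ht hst := h.reflection_le _ (hS hs) _ (hS ht) (hu hst)
  equation _ hs _ ht hst := h.equation _ (hS hs) _ (hS ht) (hu hst)
  variational _ hs _ ht hst := h.variational _ (hS hs) _ (hS ht) (hu hst)

open Filter Topology in
/-- The increment description passes to pointwise limits. -/
theorem IsIncrementSolution.of_tendsto {α : Type*} {l : Filter α} [l.NeBot]
    {wₙ : α → ι → F} {τₙ Gₙ : α → ι → ℝ} {xₙ φₙ : α → ι → E} (hσ : Continuous σ)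
    (hb : Continuous b)
    (h : ∀ᶠ k in l, IsIncrementSolution D σ b S (wₙ k) (τₙ k) (Gₙ k) C (xₙ k) (φₙ k))
    (hw : ∀ t ∈ S, Tendsto (fun k => wₙ k t) l (𝓝 (w t)))
    (hτ : ∀ t ∈ S, Tendsto (fun k => τₙ k t) l (𝓝 (τ t)))
    (hG : ∀ t ∈ S, Tendsto (fun k => Gₙ k t) l (𝓝 (G t)))
    (hx : ∀ t ∈ S, Tendsto (fun k => xₙ k t) l (𝓝 (x t)))
    (hφ : ∀ t ∈ S, Tendsto (fun k => φₙ k t) l (𝓝 (φ t))) :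
    IsIncrementSolution D σ b S w τ G C x φ where
  mem_closure t ht := isClosed_closure.mem_of_tendsto (hx t ht)
    (h.mono fun k hk => hk.mem_closure t ht)
  path_le s hs t ht hst := le_of_tendsto_of_tendsto ((hx t ht).sub (hx s hs)).norm
    (((hG t ht).sub (hG s hs)).const_mul C) (h.mono fun k hk => hk.path_le s hs t ht hst)
  reflection_le s hs t ht hst := le_of_tendsto_of_tendsto ((hφ t ht).sub (hφ s hs)).norm
    (((hG t ht).sub (hG s hs)).const_mul C) (h.mono fun k hk => hk.reflection_le s hs t ht hst)
  equation s hs t ht hst := by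
    have hσs : Tendsto (fun k => σ (xₙ k s) (wₙ k t - wₙ k s)) l (𝓝 (σ (x s) (w t - w s))) :=
      (isBoundedBilinearMap_apply.continuous.tendsto (σ (x s), w t - w s)).comp
        (((hσ.tendsto _).comp (hx s hs)).prodMk_nhds ((hw t ht).sub (hw s hs)))
    have hbs : Tendsto (fun k => (τₙ k t - τₙ k s) • b (xₙ k s)) l
        (𝓝 ((τ t - τ s) • b (x s))) :=
      ((hτ t ht).sub (hτ s hs)).smul ((hb.tendsto _).comp (hx s hs))
    exact le_of_tendsto_of_tendsto
      (((((hx t ht).sub (hx s hs)).sub hσs).sub hbs).sub ((hφ t ht).sub (hφ s hs))).norm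
      ((((hG t ht).sub (hG s hs)).pow 2).const_mul C)
      (h.mono fun k hk => hk.equation s hs t ht hst)
  variational s hs t ht hst z hz := by
    have hd := (hG t ht).sub (hG s hs)
    have hn := (tendsto_const_nhds (x := z)).sub (hx s hs)
    exact le_of_tendsto_of_tendsto
      ((((hn.norm.pow 2).add (((hn.norm.const_add 1).add hd).mul hd)).const_mul C).mul hd).neg
      (hn.inner ((hφ t ht).sub (hφ s hs)))
      (h.mono fun k hk => hk.variational s hs t ht hst z hz)

/-- Two increment solutions with the same driver separate at most linearly in the control. -/
theorem IsIncrementSolution.norm_sub_sq_sub_le {K M : ℝ}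
    (hσ : ∀ y z, ‖σ y - σ z‖ ≤ K * ‖y - z‖) (hb : ∀ y z, ‖b y - b z‖ ≤ K * ‖y - z‖)
    (hK : 0 ≤ K) (hC : 0 ≤ C)
    (h : IsIncrementSolution D σ b S w τ G C x φ)
    (h' : IsIncrementSolution D σ b S w τ G C x' φ') {s t : ι} (hs : s ∈ S) (ht : t ∈ S)
    (hst : s ≤ t) (hw : ‖w t - w s‖ ≤ G t - G s) (hτ : |τ t - τ s| ≤ G t - G s)
    (hM : ‖x s - x' s‖ ≤ M) (hM' : G t - G s ≤ M) :
    ‖x t - x' t‖ ^ 2 - ‖x s - x' s‖ ^ 2 ≤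
      (4 * K + 4 * C) * ‖x s - x' s‖ ^ 2 * (G t - G s) +
        (4 * C * M + 4 * C * (1 + 2 * M) + 4 * C ^ 2) * (G t - G s) ^ 2 := by
  set u := x s - x' s with hu
  set δ := G t - G s with hδ
  have hδ0 : 0 ≤ δ := (norm_nonneg _).trans hw
  set e := x t - x s - σ (x s) (w t - w s) - (τ t - τ s) • b (x s) - (φ t - φ s) with he
  set e' := x' t - x' s - σ (x' s) (w t - w s) - (τ t - τ s) • b (x' s) - (φ' t - φ' s) with he'
  have hen : ‖e‖ ≤ C * δ ^ 2 := h.equation s hs t ht hst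
  have hen' : ‖e'‖ ≤ C * δ ^ 2 := h'.equation s hs t ht hst
  set du := (x t - x' t) - u with hdu
  have hdun : ‖du‖ ≤ 2 * C * δ := by
    have h1 := h.path_le s hs t ht hst
    have h2 := h'.path_le s hs t ht hst
    calc ‖du‖ = ‖(x t - x s) - (x' t - x' s)‖ := by rw [hdu, hu]; congr 1; abel
      _ ≤ _ := norm_sub_le _ _
      _ ≤ _ := by linarith
  have hsplit : du = e - e' + (σ (x s) - σ (x' s)) (w t - w s) +
      (τ t - τ s) • (b (x s) - b (x' s)) + (φ t - φ s) - (φ' t - φ' s) := by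
    rw [hdu, he, he', hu, FunLike.coe_sub, Pi.sub_apply, smul_sub]; abel
  have hsq : ‖x t - x' t‖ ^ 2 - ‖u‖ ^ 2 = 2 * inner ℝ u du + ‖du‖ ^ 2 := by
    have := norm_add_sq_real u du
    rw [show u + du = x t - x' t by rw [hdu]; abel] at this
    linarith
  have h1 : inner ℝ u e ≤ C * M * δ ^ 2 := (real_inner_le_norm _ _).trans <| by
    calc ‖u‖ * ‖e‖ ≤ M * (C * δ ^ 2) := mul_le_mul hM hen (norm_nonneg _) ((norm_nonneg _).trans hM)
      _ = _ := by ring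
  have h2 : -inner ℝ u e' ≤ C * M * δ ^ 2 := by
    rw [← inner_neg_right]
    refine (real_inner_le_norm _ _).trans ?_
    rw [norm_neg]
    calc ‖u‖ * ‖e'‖ ≤ M * (C * δ ^ 2) :=
          mul_le_mul hM hen' (norm_nonneg _) ((norm_nonneg _).trans hM)
      _ = _ := by ring
  have h3 : inner ℝ u ((σ (x s) - σ (x' s)) (w t - w s)) ≤ K * ‖u‖ ^ 2 * δ := by
    refine (real_inner_le_norm _ _).trans ?_
    have h4 : ‖(σ (x s) - σ (x' s)) (w t - w s)‖ ≤ K * ‖u‖ * δ :=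
      (ContinuousLinearMap.le_opNorm _ _).trans
        (mul_le_mul (hσ _ _) hw (norm_nonneg _) (by positivity))
    calc _ ≤ ‖u‖ * (K * ‖u‖ * δ) := mul_le_mul_of_nonneg_left h4 (norm_nonneg _)
      _ = _ := by ring
  have h4 : inner ℝ u ((τ t - τ s) • (b (x s) - b (x' s))) ≤ K * ‖u‖ ^ 2 * δ := by
    refine (real_inner_le_norm _ _).trans ?_
    have h4 : ‖(τ t - τ s) • (b (x s) - b (x' s))‖ ≤ δ * (K * ‖u‖) := by
      rw [norm_smul]
      exact mul_le_mul hτ (hb _ _) (norm_nonneg _) hδ0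
    calc _ ≤ ‖u‖ * (δ * (K * ‖u‖)) := mul_le_mul_of_nonneg_left h4 (norm_nonneg _)
      _ = _ := by ring
  have hquad : C * (‖u‖ ^ 2 + (1 + ‖u‖ + δ) * δ) * δ ≤ C * ‖u‖ ^ 2 * δ + C * (1 + 2 * M) * δ ^ 2 := by
    have : C * ((1 + ‖u‖ + δ) * δ) * δ ≤ C * ((1 + M + M) * δ) * δ := by gcongr
    nlinarith
  -- Each reflection is tested with the position of the other path, which is admissible because both
  -- lie in the closure of `D`.
  have h5 : inner ℝ u (φ t - φ s) ≤ C * ‖u‖ ^ 2 * δ + C * (1 + 2 * M) * δ ^ 2 := by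
    have := h.variational s hs t ht hst (x' s) (h'.mem_closure s hs)
    rw [← neg_sub (x s) (x' s), ← hu, norm_neg, inner_neg_left, ← hδ] at this
    linarith
  have h6 : -inner ℝ u (φ' t - φ' s) ≤ C * ‖u‖ ^ 2 * δ + C * (1 + 2 * M) * δ ^ 2 := by
    have := h'.variational s hs t ht hst (x s) (h.mem_closure s hs)
    rw [← hu, ← hδ] at this
    linarith
  have h7 : ‖du‖ ^ 2 ≤ 4 * C ^ 2 * δ ^ 2 := by
    have := pow_le_pow_left₀ (norm_nonneg _) hdun 2
    calc _ ≤ _ := this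
      _ = _ := by ring
  have h8 : inner ℝ u du = inner ℝ u e - inner ℝ u e' +
      inner ℝ u ((σ (x s) - σ (x' s)) (w t - w s)) +
      inner ℝ u ((τ t - τ s) • (b (x s) - b (x' s))) + inner ℝ u (φ t - φ s) -
      inner ℝ u (φ' t - φ' s) := by
    rw [hsplit]; simp only [inner_add_right, inner_sub_right]
  rw [hsq, h8]
  linarith

/-- Increment solutions with the same driver and the same starting point agree. -/
theorem IsIncrementSolution.eqOn {T C C' : ℝ} {w : ℝ → F} {G G' : ℝ → ℝ} {x x' φ φ' : ℝ → E}
    {Kσ Kb : ℝ≥0} (hσ : LipschitzWith Kσ σ) (hb : LipschitzWith Kb b) (hC : 0 ≤ C) (hC' : 0 ≤ C')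
    (hG : ContinuousOn G (Icc 0 T)) (hGm : MonotoneOn G (Icc 0 T))
    (hG' : ContinuousOn G' (Icc 0 T)) (hGm' : MonotoneOn G' (Icc 0 T))
    (hw : ∀ s ∈ Icc 0 T, ∀ t ∈ Icc 0 T, s ≤ t → ‖w t - w s‖ ≤ G t - G s)
    (hτ : ∀ s ∈ Icc 0 T, ∀ t ∈ Icc 0 T, s ≤ t → t - s ≤ G t - G s)
    (h : IsIncrementSolution D σ b (Icc 0 T) w id G C x φ)
    (h' : IsIncrementSolution D σ b (Icc 0 T) w id G' C' x' φ') (h0 : x 0 = x' 0) :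
    EqOn x x' (Icc 0 T) := by
  intro r hr
  have hT : 0 ≤ T := hr.1.trans hr.2
  set H : ℝ → ℝ := fun t => G t + G' t with hH
  have hHc : ContinuousOn H (Icc 0 T) := hG.add hG'
  have hHm : MonotoneOn H (Icc 0 T) := hGm.add hGm'
  have hGd : ∀ s ∈ Icc 0 T, ∀ t ∈ Icc 0 T, s ≤ t → 0 ≤ G t - G s :=
    fun s hs t ht hst => sub_nonneg.2 (hGm hs ht hst)
  have hGd' : ∀ s ∈ Icc 0 T, ∀ t ∈ Icc 0 T, s ≤ t → 0 ≤ G' t - G' s :=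
    fun s hs t ht hst => sub_nonneg.2 (hGm' hs ht hst)
  have hle : ∀ s ∈ Icc 0 T, ∀ t ∈ Icc 0 T, s ≤ t → G t - G s ≤ H t - H s := by
    intro s hs t ht hst
    have := hGd' s hs t ht hst
    simp only [hH]; linarith
  have hle' : ∀ s ∈ Icc 0 T, ∀ t ∈ Icc 0 T, s ≤ t → G' t - G' s ≤ H t - H s := by
    intro s hs t ht hst
    have := hGd s hs t ht hst
    simp only [hH]; linarith
  have k := h.mono_control (C' := C + C') hC (by linarith) hGd hle
  have k' := h'.mono_control (C' := C + C') hC' (by linarith) hGd' hle'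
  set B := C + C' with hB
  have hB0 : 0 ≤ B := add_nonneg hC hC'
  -- The first summand bounds the distance of the paths, which start together; the second bounds
  -- every increment of `H`.
  set M := 2 * B * (H T - H 0) + (H T - H 0) with hMdef
  have h0m : (0 : ℝ) ∈ Icc 0 T := ⟨le_rfl, hT⟩
  have hTm : T ∈ Icc 0 T := ⟨hT, le_rfl⟩
  have hHT : 0 ≤ H T - H 0 := sub_nonneg.2 (hHm h0m hTm hT)
  have hM0 : 0 ≤ M := by positivity
  have hK : ∀ y z, ‖σ y - σ z‖ ≤ (Kσ + Kb : ℝ) * ‖y - z‖ := fun y z =>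
    (hσ.norm_sub_le y z).trans (by gcongr; simp)
  have hK' : ∀ y z, ‖b y - b z‖ ≤ (Kσ + Kb : ℝ) * ‖y - z‖ := fun y z =>
    (hb.norm_sub_le y z).trans (by gcongr; simp)
  have hsub : Icc 0 r ⊆ Icc 0 T := Icc_subset_Icc_right hr.2
  have key := le_exp_mul_of_increment_le (a := 0) (b := r) (K := 4 * (Kσ + Kb : ℝ) + 4 * B)
    (C := 4 * B * M + 4 * B * (1 + 2 * M) + 4 * B ^ 2) (f := fun t => ‖x t - x' t‖ ^ 2) (G := H)
    hr.1 (by positivity) (by positivity) (hHc.mono hsub) (hHm.mono hsub)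
    (fun t => by positivity) (by
      intro s hs t ht hst
      have hs' := hsub hs
      have ht' := hsub ht
      have hHs : H s - H 0 ≤ H T - H 0 := sub_le_sub_right (hHm hs' hTm hs'.2) _
      have hst' : H t - H s ≤ H T - H 0 := sub_le_sub (hHm ht' hTm ht'.2) (hHm h0m hs' hs'.1)
      refine k.norm_sub_sq_sub_le hK hK' (by positivity) hB0 k' hs' ht' hst
        ((hw s hs' t ht' hst).trans (hle s hs' t ht' hst)) ?_ ?_ ?_
      · simp only [id]
        rw [abs_of_nonneg (sub_nonneg.2 hst)]
        exact (hτ s hs' t ht' hst).trans (hle s hs' t ht' hst)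
      · have h1 := k.path_le 0 h0m s hs' hs'.1
        have h2 := k'.path_le 0 h0m s hs' hs'.1
        have h3 : ‖x s - x' s‖ ≤ 2 * B * (H s - H 0) := by
          calc ‖x s - x' s‖ = ‖(x s - x 0) - (x' s - x' 0)‖ := by rw [h0]; congr 1; abel
            _ ≤ _ := norm_sub_le _ _
            _ ≤ _ := by linarith
        have h4 : 2 * B * (H s - H 0) ≤ 2 * B * (H T - H 0) := by gcongr
        linarith
      · have : 0 ≤ 2 * B * (H T - H 0) := by positivity
        linarith)
  simp only [h0, sub_self, norm_zero] at key
  have : ‖x r - x' r‖ = 0 := by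
    have h1 : ‖x r - x' r‖ ^ 2 ≤ 0 := by simpa using key
    nlinarith [norm_nonneg (x r - x' r)]
  exact sub_eq_zero.1 (norm_eq_zero.1 this)

end IncrementSolutions

/-! ### The projected Euler scheme -/

section EulerScheme

variable {E F : Type*} [NormedAddCommGroup E] [InnerProductSpace ℝ E]
  [NormedAddCommGroup F] [NormedSpace ℝ F]
  {D : Set E} {σ : E → F →L[ℝ] E} {b : E → E}

/-- One-step estimates for a discrete reflected scheme add up to the increment description. -/
theorem isIncrementSolution_of_steps {M K c : ℝ} (hM : 0 ≤ M) (hK : 0 ≤ K) (hc : 0 ≤ c)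
    (hσM : ∀ z, ‖σ z‖ ≤ M) (hbM : ∀ z, ‖b z‖ ≤ M)
    (hσ : ∀ y z, ‖σ y - σ z‖ ≤ K * ‖y - z‖) (hb : ∀ y z, ‖b y - b z‖ ≤ K * ‖y - z‖)
    {w : ℕ → F} {τ V : ℕ → ℝ} (hτ : ∀ j, τ j ≤ τ (j + 1))
    (hV : ∀ j, ‖w (j + 1) - w j‖ + (τ (j + 1) - τ j) ≤ V (j + 1) - V j)
    {x φ : ℕ → E} (hx : ∀ j, x j ∈ closure D)
    (hstep : ∀ j, x (j + 1) - x j =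
      σ (x j) (w (j + 1) - w j) + (τ (j + 1) - τ j) • b (x j) + (φ (j + 1) - φ j))
    (hφ : ∀ j, ‖φ (j + 1) - φ j‖ ≤ M * (V (j + 1) - V j))
    (hvar : ∀ j, ∀ z ∈ closure D, -(c * (V (j + 1) - V j) * ‖z - x (j + 1)‖ ^ 2) ≤
      inner ℝ (z - x (j + 1)) (φ (j + 1) - φ j)) :
    IsIncrementSolution D σ b univ w τ V
      (2 * M + 2 * M * K + c + 2 * M ^ 2 + 4 * M * c + 4 * M ^ 2 * c) x φ := by
  have hVs : ∀ j, 0 ≤ V (j + 1) - V j := fun j =>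
    le_trans (add_nonneg (norm_nonneg _) (sub_nonneg.2 (hτ j))) (hV j)
  have hVm : Monotone V := monotone_nat_of_le_succ fun j => sub_nonneg.1 (hVs j)
  have hlin : ∀ (A : F →L[ℝ] E) (v : E) (N : ℝ) (j : ℕ), ‖A‖ ≤ N → ‖v‖ ≤ N →
      ‖A (w (j + 1) - w j) + (τ (j + 1) - τ j) • v‖ ≤ N * (V (j + 1) - V j) := by
    intro A v N j hA hv
    have hN : 0 ≤ N := (norm_nonneg _).trans hA
    have hτj := sub_nonneg.2 (hτ j)
    calc _ ≤ ‖A (w (j + 1) - w j)‖ + ‖(τ (j + 1) - τ j) • v‖ := norm_add_le _ _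
      _ ≤ N * ‖w (j + 1) - w j‖ + (τ (j + 1) - τ j) * N := by
        refine add_le_add (A.le_of_opNorm_le hA _) ?_
        rw [norm_smul, Real.norm_eq_abs, abs_of_nonneg hτj]
        exact mul_le_mul_of_nonneg_left hv hτj
      _ = N * (‖w (j + 1) - w j‖ + (τ (j + 1) - τ j)) := by ring
      _ ≤ _ := mul_le_mul_of_nonneg_left (hV j) hN
  have hxs : ∀ j, ‖x (j + 1) - x j‖ ≤ 2 * M * (V (j + 1) - V j) := by
    intro j
    rw [hstep j]
    have h1 := hlin (σ (x j)) (b (x j)) M j (hσM _) (hbM _)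
    have h2 := hφ j
    calc _ ≤ _ := norm_add_le _ _
      _ ≤ _ := by linarith
  have hsum : ∀ (y : ℕ → E) (N : ℝ), (∀ j, ‖y (j + 1) - y j‖ ≤ N * (V (j + 1) - V j)) →
      ∀ i k, i ≤ k → ‖y k - y i‖ ≤ N * (V k - V i) := by
    intro y N hy i k hik
    induction k, hik using Nat.le_induction with
    | base => simp
    | succ k hik ih =>
      calc ‖y (k + 1) - y i‖ = ‖(y (k + 1) - y k) + (y k - y i)‖ := by congr 1; abel
        _ ≤ _ := norm_add_le _ _
        _ ≤ _ := by have := hy k; linarith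
  have hxi := hsum x _ hxs
  have hφi := hsum φ _ hφ
  -- Replacing the coefficients at `x k` by those at `x i` costs `K * 2M (V k - V i)` per unit of
  -- control, and these costs sum to a quadratic error.
  have heq : ∀ i k, i ≤ k →
      ‖x k - x i - σ (x i) (w k - w i) - (τ k - τ i) • b (x i) - (φ k - φ i)‖ ≤
        2 * M * K * (V k - V i) ^ 2 := by
    intro i k hik
    induction k, hik using Nat.le_induction with
    | base => simp
    | succ k hik ih =>
      have hv : 0 ≤ V k - V i := sub_nonneg.2 (hVm hik)
      have h1 := hlin (σ (x k) - σ (x i)) (b (x k) - b (x i)) (K * ‖x k - x i‖) k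
        (hσ _ _) (hb _ _)
      have h2 : K * ‖x k - x i‖ * (V (k + 1) - V k) ≤
          K * (2 * M * (V k - V i)) * (V (k + 1) - V k) :=
        mul_le_mul_of_nonneg_right (mul_le_mul_of_nonneg_left (hxi i k hik) hK) (hVs k)
      have h3 : x (k + 1) - x i - σ (x i) (w (k + 1) - w i) - (τ (k + 1) - τ i) • b (x i) -
          (φ (k + 1) - φ i) =
          (x k - x i - σ (x i) (w k - w i) - (τ k - τ i) • b (x i) - (φ k - φ i)) +
          ((σ (x k) - σ (x i)) (w (k + 1) - w k) +
            (τ (k + 1) - τ k) • (b (x k) - b (x i))) := by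
        have h4 : x (k + 1) = x k + (σ (x k) (w (k + 1) - w k) + (τ (k + 1) - τ k) • b (x k) +
          (φ (k + 1) - φ k)) := by rw [← hstep k]; abel
        rw [h4, FunLike.coe_sub, Pi.sub_apply, smul_sub]
        simp only [map_sub, sub_smul]
        abel
      rw [h3]
      refine (norm_add_le _ _).trans ?_
      have h5 : 0 ≤ M * K * (V k - V i) * (V (k + 1) - V k) :=
        mul_nonneg (by positivity) (hVs k)
      have h6 : 0 ≤ M * K * (V (k + 1) - V k) ^ 2 := by positivity
      nlinarith
  -- The one-step inequality is centred at `x (k + 1)`. Recentring at `x i` uses `‖x (k + 1) - x i‖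
  -- ≤ 2M (v + d)`; expanding the square leaves `c * a ^ 2 * d` and terms with the factor `(v + d) *
  -- d`, which sum through `v ^ 2 + (v + d) * d ≤ (v + d) ^ 2`.
  have hvari : ∀ i k, i ≤ k → ∀ z ∈ closure D,
      -(c * ‖z - x i‖ ^ 2 * (V k - V i) +
        (2 * M ^ 2 + 4 * M * c * ‖z - x i‖ + 4 * M ^ 2 * c * (V k - V i)) * (V k - V i) ^ 2) ≤
        inner ℝ (z - x i) (φ k - φ i) := by
    intro i k hik z hz
    induction k, hik using Nat.le_induction with
    | base => simp
    | succ k hik ih =>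
      have hv : 0 ≤ V k - V i := sub_nonneg.2 (hVm hik)
      have hd := hVs k
      have hxk := hxi i (k + 1) (by omega)
      have h1 := hvar k z hz
      set a := ‖z - x i‖ with ha
      have ha0 : 0 ≤ a := norm_nonneg _
      set v := V k - V i with hv_def
      set d := V (k + 1) - V k with hd_def
      have hvd : V (k + 1) - V i = v + d := by rw [hv_def, hd_def]; ring
      rw [hvd] at hxk ⊢
      have h2 : ‖z - x (k + 1)‖ ≤ a + 2 * M * (v + d) := by
        calc ‖z - x (k + 1)‖ = ‖(z - x i) - (x (k + 1) - x i)‖ := by congr 1; abel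
          _ ≤ _ := norm_sub_le _ _
          _ ≤ _ := by linarith
      have h3 : c * d * ‖z - x (k + 1)‖ ^ 2 ≤ c * d * (a + 2 * M * (v + d)) ^ 2 := by gcongr
      have h4 : -(2 * M * (v + d) * (M * d)) ≤
          inner ℝ (x (k + 1) - x i) (φ (k + 1) - φ k) := by
        have h5 := neg_abs_le (inner ℝ (x (k + 1) - x i) (φ (k + 1) - φ k))
        have h6 := abs_real_inner_le_norm (x (k + 1) - x i) (φ (k + 1) - φ k)
        have h7 : ‖x (k + 1) - x i‖ * ‖φ (k + 1) - φ k‖ ≤ 2 * M * (v + d) * (M * d) :=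
          mul_le_mul hxk (hφ k) (norm_nonneg _) (by positivity)
        linarith
      have h8 : inner ℝ (z - x i) (φ (k + 1) - φ i) = inner ℝ (z - x i) (φ k - φ i) +
          inner ℝ (z - x (k + 1)) (φ (k + 1) - φ k) +
          inner ℝ (x (k + 1) - x i) (φ (k + 1) - φ k) := by
        rw [add_assoc, ← inner_add_left, sub_add_sub_cancel, ← inner_add_right]
        congr 1; abel
      rw [h8]
      have hL : (2 * M ^ 2 + 4 * M * c * a + 4 * M ^ 2 * c * v) * v ^ 2 +
          (2 * M ^ 2 + 4 * M * c * a + 4 * M ^ 2 * c * (v + d)) * ((v + d) * d) ≤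
          (2 * M ^ 2 + 4 * M * c * a + 4 * M ^ 2 * c * (v + d)) * (v + d) ^ 2 := by
        have h9 : (2 * M ^ 2 + 4 * M * c * a + 4 * M ^ 2 * c * v) * v ^ 2 ≤
            (2 * M ^ 2 + 4 * M * c * a + 4 * M ^ 2 * c * (v + d)) * v ^ 2 := by
          gcongr; linarith
        have h10 : (2 * M ^ 2 + 4 * M * c * a + 4 * M ^ 2 * c * (v + d)) * (v ^ 2 + (v + d) * d) ≤
            (2 * M ^ 2 + 4 * M * c * a + 4 * M ^ 2 * c * (v + d)) * (v + d) ^ 2 := by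
          gcongr
          nlinarith [mul_nonneg hv hd]
        linarith
      have h11 : c * d * (a + 2 * M * (v + d)) ^ 2 + 2 * M * (v + d) * (M * d) =
          c * a ^ 2 * d +
          (2 * M ^ 2 + 4 * M * c * a + 4 * M ^ 2 * c * (v + d)) * ((v + d) * d) := by ring
      linarith
  have hdiff : ∀ s t, s ≤ t → 0 ≤ V t - V s := fun s t hst => sub_nonneg.2 (hVm hst)
  refine ⟨fun t _ => hx t, fun s _ t _ hst => ?_, fun s _ t _ hst => ?_, fun s _ t _ hst => ?_,
    fun s _ t _ hst z hz => ?_⟩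
  · refine (hxi s t hst).trans (mul_le_mul_of_nonneg_right ?_ (hdiff s t hst))
    have : 0 ≤ 2 * M * K + c + 2 * M ^ 2 + 4 * M * c + 4 * M ^ 2 * c := by positivity
    linarith
  · refine (hφi s t hst).trans (mul_le_mul_of_nonneg_right ?_ (hdiff s t hst))
    have : 0 ≤ 2 * M * K + c + 2 * M ^ 2 + 4 * M * c + 4 * M ^ 2 * c := by positivity
    linarith
  · refine (heq s t hst).trans (mul_le_mul_of_nonneg_right ?_ (by positivity))
    have : 0 ≤ c + 2 * M ^ 2 + 4 * M * c + 4 * M ^ 2 * c := by positivity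
    linarith
  · refine le_trans (neg_le_neg ?_) (hvari s t hst z hz)
    have hv := hdiff s t hst
    have ha := norm_nonneg (z - x s)
    set a := ‖z - x s‖
    set v := V t - V s
    set B := 2 * M + 2 * M * K + c + 2 * M ^ 2 + 4 * M * c + 4 * M ^ 2 * c with hB
    have hcB : c ≤ B := by
      have : 0 ≤ 2 * M + 2 * M * K + 2 * M ^ 2 + 4 * M * c + 4 * M ^ 2 * c := by positivity
      linarith
    have hB1 : 2 * M ^ 2 ≤ B := by
      have : 0 ≤ 2 * M + 2 * M * K + c + 4 * M * c + 4 * M ^ 2 * c := by positivity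
      linarith
    have hB2 : 4 * M * c ≤ B := by
      have : 0 ≤ 2 * M + 2 * M * K + c + 2 * M ^ 2 + 4 * M ^ 2 * c := by positivity
      linarith
    have hB3 : 4 * M ^ 2 * c ≤ B := by
      have : 0 ≤ 2 * M + 2 * M * K + c + 2 * M ^ 2 + 4 * M * c := by positivity
      linarith
    calc _ ≤ B * a ^ 2 * v + (B + B * a + B * v) * v ^ 2 := by gcongr
      _ = _ := by ring

/-- A nearest point of `closure D`. -/
theorem exists_nearest {E : Type*} [NormedAddCommGroup E] [ProperSpace E] {D : Set E}
    (hD : D.Nonempty) (p : E) :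
    ∃ q ∈ closure D, ∀ z ∈ closure D, ‖q - p‖ ≤ ‖z - p‖ := by
  obtain ⟨q, hq, h⟩ := isClosed_closure.exists_infDist_eq_dist hD.closure p
  refine ⟨q, hq, fun z hz => ?_⟩
  rw [← dist_eq_norm, ← dist_eq_norm, dist_comm q, dist_comm z, ← h]
  exact Metric.infDist_le_dist_of_mem hz

/-- The projected Euler scheme along a discrete driver. -/
theorem exists_euler_scheme [ProperSpace E] (hD : IsOpen D) {r₀ : ℝ} (hr₀ : 0 < r₀)
    (hA : ∀ x ∈ frontier D, normals D x = normalsOfRadius D x r₀)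
    {M K : ℝ} (hM : 0 ≤ M) (hK : 0 ≤ K)
    (hσM : ∀ z, ‖σ z‖ ≤ M) (hbM : ∀ z, ‖b z‖ ≤ M)
    (hσ : ∀ y z, ‖σ y - σ z‖ ≤ K * ‖y - z‖) (hb : ∀ y z, ‖b y - b z‖ ≤ K * ‖y - z‖)
    {x₀ : E} (hx₀ : x₀ ∈ closure D) :
    ∃ C : ℝ, 0 ≤ C ∧ ∀ (w : ℕ → F) (τ V : ℕ → ℝ), (∀ j, τ j ≤ τ (j + 1)) →
      (∀ j, ‖w (j + 1) - w j‖ + (τ (j + 1) - τ j) ≤ V (j + 1) - V j) →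
      ∃ x φ : ℕ → E, x 0 = x₀ ∧ φ 0 = 0 ∧ IsIncrementSolution D σ b univ w τ V C x φ := by
  have hne : D.Nonempty := closure_nonempty_iff.1 ⟨x₀, hx₀⟩
  choose P hPmem hP using exists_nearest hne
  set c := M / (2 * r₀) with hc
  have hc0 : 0 ≤ c := by positivity
  refine ⟨2 * M + 2 * M * K + c + 2 * M ^ 2 + 4 * M * c + 4 * M ^ 2 * c, by positivity,
    fun w τ V hτ hV => ?_⟩
  set p : ℕ → E → E := fun j y => y + (σ y (w (j + 1) - w j) + (τ (j + 1) - τ j) • b y) with hp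
  set x : ℕ → E := fun j => Nat.rec x₀ (fun j y => P (p j y)) j with hx
  have hxs : ∀ j, x (j + 1) = P (p j (x j)) := fun j => rfl
  set φ : ℕ → E := fun j => ∑ i ∈ Finset.range j, (x (i + 1) - p i (x i)) with hφ
  have hφs : ∀ j, φ (j + 1) - φ j = x (j + 1) - p j (x j) := fun j => by
    simp only [hφ, Finset.sum_range_succ, add_sub_cancel_left]
  have hxmem : ∀ j, x j ∈ closure D := fun j => by
    cases j with
    | zero => exact hx₀
    | succ j => exact hPmem _
  -- The previous position `x j` competes for the nearest point, so the projection moves no further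
  -- than the free step did.
  have hφn : ∀ j, ‖φ (j + 1) - φ j‖ ≤ M * (V (j + 1) - V j) := by
    intro j
    rw [hφs, hxs]
    refine (hP (p j (x j)) (x j) (hxmem j)).trans ?_
    rw [hp, sub_add_cancel_left, norm_neg]
    have hτj := sub_nonneg.2 (hτ j)
    calc _ ≤ ‖σ (x j) (w (j + 1) - w j)‖ + ‖(τ (j + 1) - τ j) • b (x j)‖ := norm_add_le _ _
      _ ≤ M * ‖w (j + 1) - w j‖ + (τ (j + 1) - τ j) * M := by
        refine add_le_add (ContinuousLinearMap.le_of_opNorm_le _ (hσM _) _) ?_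
        rw [norm_smul, Real.norm_eq_abs, abs_of_nonneg hτj]
        exact mul_le_mul_of_nonneg_left (hbM _) hτj
      _ = M * (‖w (j + 1) - w j‖ + (τ (j + 1) - τ j)) := by ring
      _ ≤ _ := mul_le_mul_of_nonneg_left (hV j) hM
  refine ⟨x, φ, rfl, by simp [hφ], isIncrementSolution_of_steps hM hK hc0 hσM hbM hσ hb hτ hV
    hxmem (fun j => ?_) hφn (fun j z hz => ?_)⟩
  · rw [hφs]; simp only [hp]; abel
  · have h1 := neg_le_inner_of_nearest hr₀ hD hA (hPmem (p j (x j))) (hP (p j (x j))) hz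
    have h2 := hφn j
    rw [hφs] at h2 ⊢
    rw [← hxs] at h1
    refine le_trans (neg_le_neg ?_) h1
    have h3 : ‖x (j + 1) - p j (x j)‖ / (2 * r₀) ≤ c * (V (j + 1) - V j) := by
      rw [hc, div_mul_eq_mul_div]
      gcongr
    exact mul_le_mul_of_nonneg_right h3 (by positivity)

open Filter Topology in
/-- Existence of an increment solution for a driver on `[0, ∞)` with a continuous control. -/
theorem exists_isIncrementSolution [FiniteDimensional ℝ E] (hD : IsOpen D) {r₀ : ℝ} (hr₀ : 0 < r₀)
    (hA : ∀ x ∈ frontier D, normals D x = normalsOfRadius D x r₀)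
    (hσM : ∃ M : ℝ, ∀ z, ‖σ z‖ ≤ M) (hbM : ∃ M : ℝ, ∀ z, ‖b z‖ ≤ M)
    {Kσ Kb : ℝ≥0} (hσ : LipschitzWith Kσ σ) (hb : LipschitzWith Kb b)
    {x₀ : E} (hx₀ : x₀ ∈ closure D) {w : ℝ → F} {V : ℝ → ℝ} (hw : Continuous w)
    (hV : Continuous V) (hwV : ∀ s t, s ≤ t → ‖w t - w s‖ + (t - s) ≤ V t - V s) :
    ∃ C : ℝ, 0 ≤ C ∧ ∃ x φ : ℝ → E, x 0 = x₀ ∧ φ 0 = 0 ∧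
      IsIncrementSolution D σ b (Ici 0) w id V C x φ := by
  have : ProperSpace E := FiniteDimensional.proper ℝ E
  obtain ⟨M₁, hM₁⟩ := hσM
  obtain ⟨M₂, hM₂⟩ := hbM
  have hM₁0 : 0 ≤ M₁ := (norm_nonneg _).trans (hM₁ 0)
  have hM₂0 : 0 ≤ M₂ := (norm_nonneg _).trans (hM₂ 0)
  obtain ⟨C, hC, hscheme⟩ := exists_euler_scheme (M := M₁ + M₂) (K := Kσ + Kb) (F := F) hD hr₀ hA
    (by positivity) (by positivity) (fun z => (hM₁ z).trans (by linarith))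
    (fun z => (hM₂ z).trans (by linarith))
    (fun y z => (hσ.norm_sub_le y z).trans (by gcongr; simp))
    (fun y z => (hb.norm_sub_le y z).trans (by gcongr; simp)) hx₀
  have hVm : Monotone V := fun s t hst => by
    have := hwV s t hst
    have := norm_nonneg (w t - w s)
    linarith
  -- Mesh `1 / N`; for `N = 0` all nodes are `0`, which is harmless.
  set τ : ℕ → ℕ → ℝ := fun N j => j / (N : ℝ) with hτ
  have hτm : ∀ N j, τ N j ≤ τ N (j + 1) := fun N j => by
    simp only [hτ]; gcongr; simp
  choose X Φ hX0 hΦ0 hXΦ using fun N : ℕ => hscheme (fun j => w (τ N j)) (τ N)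
    (fun j => V (τ N j)) (hτm N) (fun j => hwV _ _ (hτm N j))
  set u : ℕ → ℝ → ℕ := fun N t => ⌊t * N⌋₊ with hu
  have hum : ∀ N, Monotone (u N) := fun N s t hst =>
    Nat.floor_mono (mul_le_mul_of_nonneg_right hst (Nat.cast_nonneg N))
  have hu0 : ∀ N, u N 0 = 0 := fun N => by simp [hu]
  have hsol : ∀ N, IsIncrementSolution D σ b (Ici (0 : ℝ)) (fun t => w (τ N (u N t)))
      (fun t => τ N (u N t)) (fun t => V (τ N (u N t))) C (fun t => X N (u N t))
      (fun t => Φ N (u N t)) := fun N => (hXΦ N).comp (hum N) (mapsTo_univ _ _)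
  have hτle : ∀ N, ∀ t ∈ Ici (0 : ℝ), τ N (u N t) ≤ t := by
    intro N t ht
    rcases Nat.eq_zero_or_pos N with rfl | hN
    · simpa [hτ] using ht
    · have hN' : (0 : ℝ) < N := by exact_mod_cast hN
      simp only [hτ, hu]
      rw [div_le_iff₀ hN']
      exact Nat.floor_le (mul_nonneg ht hN'.le)
  have hτlim : ∀ t ∈ Ici (0 : ℝ), Tendsto (fun N => τ N (u N t)) atTop (𝓝 t) := fun t ht =>
    (tendsto_nat_floor_mul_div_atTop ht).comp tendsto_natCast_atTop_atTop
  -- Along one fixed ultrafilter the bounded values converge at every time simultaneously, so no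
  -- subsequence or equicontinuity argument is needed.
  have hcpt : ∀ (Y : ℕ → ℕ → E) (y₀ : E), (∀ N, Y N 0 = y₀) →
      (∀ N, ∀ t ∈ Ici (0 : ℝ),
        ‖Y N (u N t) - Y N (u N 0)‖ ≤ C * (V (τ N (u N t)) - V (τ N (u N 0)))) →
      ∀ t : ℝ, ∃ y, 0 ≤ t → Tendsto (fun N => Y N (u N t)) (hyperfilter ℕ : Filter ℕ) (𝓝 y) := by
    intro Y y₀ hY0 hY t
    by_cases ht : 0 ≤ t
    · have hmem : ∀ N, Y N (u N t) ∈ Metric.closedBall y₀ (C * (V t - V 0)) := by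
        intro N
        rw [mem_closedBall_iff_norm]
        have h1 := hY N t ht
        rw [hu0, hY0] at h1
        refine h1.trans (mul_le_mul_of_nonneg_left (sub_le_sub (hVm (hτle N t ht)) ?_) hC)
        simp [hτ]
      obtain ⟨y, -, hy⟩ := (isCompact_closedBall y₀ (C * (V t - V 0))).ultrafilter_le_nhds
        ((hyperfilter ℕ).map fun N => Y N (u N t)) (by
          rw [le_principal_iff]
          exact Filter.mem_map.2 (Eventually.of_forall hmem))
      exact ⟨y, fun _ => hy⟩
    · exact ⟨0, fun h => absurd h ht⟩
  have h0 : (0 : ℝ) ∈ Ici (0 : ℝ) := self_mem_Ici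
  choose x hx using hcpt X x₀ hX0 fun N t ht => (hsol N).path_le 0 h0 t ht ht
  choose φ hφ using hcpt Φ 0 hΦ0 fun N t ht => (hsol N).reflection_le 0 h0 t ht ht
  have hle : ((hyperfilter ℕ : Ultrafilter ℕ) : Filter ℕ) ≤ atTop := by
    rw [← Nat.cofinite_eq_atTop]; exact hyperfilter_le_cofinite
  refine ⟨C, hC, x, φ, ?_, ?_, IsIncrementSolution.of_tendsto hσ.continuous hb.continuous
    (Eventually.of_forall hsol) (fun t ht => ?_) (fun t ht => (hτlim t ht).mono_left hle)
    (fun t ht => ?_) (fun t ht => hx t ht) (fun t ht => hφ t ht)⟩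
  · refine tendsto_nhds_unique (hx 0 le_rfl) ?_
    simp only [hu0, hX0]
    exact tendsto_const_nhds
  · refine tendsto_nhds_unique (hφ 0 le_rfl) ?_
    simp only [hu0, hΦ0]
    exact tendsto_const_nhds
  · exact ((hw.tendsto t).comp (hτlim t ht)).mono_left hle
  · exact ((hV.tendsto t).comp (hτlim t ht)).mono_left hle

end EulerScheme

/-! ### The total variation of a continuous path -/

section TotalVariation

open Filter Topology

variable {E : Type*} [NormedAddCommGroup E] {T : ℝ} {φ : ℝ → E}

theorem totalVar_sub (hφ : BoundedVariationOn φ (Icc 0 T)) {s t : ℝ} (hs : 0 ≤ s) (hst : s ≤ t)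
    (ht : t ≤ T) : totalVar T φ t - totalVar T φ s = (eVariationOn φ (Icc s t)).toReal := by
  have h1 : ∀ a b, 0 ≤ a → b ≤ T → eVariationOn φ (Icc a b) ≠ ⊤ := fun a b ha hb =>
    hφ.mono (Icc_subset_Icc ha hb)
  have h2 := eVariationOn.Icc_add_Icc φ (s := univ) hs hst (mem_univ _)
  simp only [univ_inter] at h2
  rw [totalVar, totalVar, min_eq_left ht, min_eq_left (hst.trans ht), ← h2,
    ENNReal.toReal_add (h1 _ _ le_rfl (hst.trans ht)) (h1 _ _ hs ht), add_sub_cancel_left]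

theorem norm_sub_le_totalVar_sub (hφ : BoundedVariationOn φ (Icc 0 T)) {s t : ℝ} (hs : 0 ≤ s)
    (hst : s ≤ t) (ht : t ≤ T) : ‖φ t - φ s‖ ≤ totalVar T φ t - totalVar T φ s := by
  rw [totalVar_sub hφ hs hst ht, ← dist_eq_norm]
  exact (hφ.mono (Icc_subset_Icc hs ht)).dist_le ⟨hst, le_rfl⟩ ⟨le_rfl, hst⟩

theorem totalVar_eq_clamp (hT : 0 ≤ T) (t : ℝ) :
    totalVar T φ t = totalVar T φ (max 0 (min t T)) := by
  rcases le_total t 0 with h | h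
  · rw [max_eq_left ((min_le_left _ _).trans h)]
    have hsub : ∀ a ≤ (0 : ℝ), (Icc 0 (min a T)).Subsingleton := fun a ha =>
      subsingleton_Icc_of_ge ((min_le_left _ _).trans ha)
    rw [totalVar, totalVar, eVariationOn.subsingleton _ (hsub t h),
      eVariationOn.subsingleton _ (hsub 0 le_rfl)]
  · rw [max_eq_right (le_min h hT), totalVar, totalVar, min_assoc, min_self]

theorem norm_clamp_sub_le_totalVar_sub (hφ : BoundedVariationOn φ (Icc 0 T)) (hT : 0 ≤ T)
    {s t : ℝ} (hst : s ≤ t) :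
    ‖clamp T φ t - clamp T φ s‖ ≤ totalVar T φ t - totalVar T φ s := by
  rw [totalVar_eq_clamp hT t, totalVar_eq_clamp hT s]
  exact norm_sub_le_totalVar_sub hφ (le_max_left _ _)
    (max_le_max le_rfl (min_le_min_right _ hst)) (max_le hT (min_le_right _ _))

theorem clamp_of_mem {E : Type*} {φ : ℝ → E} {t : ℝ} (ht : t ∈ Icc 0 T) : clamp T φ t = φ t := by
  rw [clamp, min_eq_left ht.2, max_eq_right ht.1]

theorem continuous_clamp (hT : 0 ≤ T) (hφc : ContinuousOn φ (Icc 0 T)) :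
    Continuous (clamp T φ) :=
  hφc.comp_continuous (by fun_prop) fun _ => ⟨le_max_left _ _, max_le hT (min_le_right _ _)⟩

/-- At a continuity point the variation over shrinking one-sided intervals tends to zero; the sum of
the left and right variations dominates the increment on either side. -/
theorem continuousOn_totalVar (hφ : BoundedVariationOn φ (Icc 0 T))
    (hφc : ContinuousOn φ (Icc 0 T)) : ContinuousOn (totalVar T φ) (Icc 0 T) := by
  intro x hx
  have hl := hφ.tendsto_eVariationOn_Icc_zero_left ((hφc x hx).mono inter_subset_left)
  have hr := hφ.tendsto_eVariationOn_Icc_zero_right x ((hφc x hx).mono inter_subset_left)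
  have hsum := hl.add hr
  rw [add_zero] at hsum
  have hreal := (ENNReal.tendsto_toReal ENNReal.zero_ne_top).comp hsum
  rw [ENNReal.toReal_zero] at hreal
  refine tendsto_iff_dist_tendsto_zero.2 (squeeze_zero' (Eventually.of_forall fun _ => dist_nonneg)
    ?_ hreal)
  filter_upwards [self_mem_nhdsWithin] with y hy
  have hfin : ∀ a b, eVariationOn φ (Icc 0 T ∩ Icc a b) ≠ ⊤ := fun a b => hφ.mono inter_subset_left
  have hinter : ∀ a ∈ Icc 0 T, ∀ b ∈ Icc 0 T, Icc 0 T ∩ Icc a b = Icc a b := fun a ha b hb =>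
    inter_eq_self_of_subset_right (Icc_subset_Icc ha.1 hb.2)
  simp only [Function.comp]
  rw [ENNReal.toReal_add (hfin _ _) (hfin _ _), Real.dist_eq]
  rcases le_total x y with hxy | hxy
  · rw [totalVar_sub hφ hx.1 hxy hy.2, ENNReal.abs_toReal, hinter x hx y hy]
    exact le_add_of_nonneg_left ENNReal.toReal_nonneg
  · rw [abs_sub_comm, totalVar_sub hφ hy.1 hxy hx.2, ENNReal.abs_toReal, hinter y hy x hx]
    exact le_add_of_nonneg_right ENNReal.toReal_nonneg

theorem continuous_totalVar (hφ : BoundedVariationOn φ (Icc 0 T)) (hT : 0 ≤ T)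
    (hφc : ContinuousOn φ (Icc 0 T)) : Continuous (totalVar T φ) := by
  have : totalVar T φ = clamp T (totalVar T φ) := funext fun t => totalVar_eq_clamp hT t
  rw [this]
  exact continuous_clamp hT (continuousOn_totalVar hφ hφc)

theorem totalVar_zero : totalVar T φ 0 = 0 := by
  rw [totalVar, eVariationOn.subsingleton _ (subsingleton_Icc_of_ge (min_le_left _ _)),
    ENNReal.toReal_zero]

theorem stieltjesFunction_eq_of_continuous {f : ℝ → ℝ} (hf : Monotone f) (hc : Continuous f)
    (x : ℝ) : hf.stieltjesFunction x = f x :=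
  hf.stieltjesFunction_eq x ▸ hc.continuousAt.continuousWithinAt.rightLim_eq

theorem stieltjesFunction_measure_Ioc {f : ℝ → ℝ} (hf : Monotone f) (hc : Continuous f)
    (s t : ℝ) : hf.stieltjesFunction.measure (Ioc s t) = ENNReal.ofReal (f t - f s) := by
  rw [StieltjesFunction.measure_Ioc, stieltjesFunction_eq_of_continuous hf hc,
    stieltjesFunction_eq_of_continuous hf hc]

theorem noAtoms_stieltjesFunction_measure {f : ℝ → ℝ} (hf : Monotone f) (hc : Continuous f) :
    NullSingletonClass hf.stieltjesFunction.measure := by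
  have h : ⇑hf.stieltjesFunction = f := funext (stieltjesFunction_eq_of_continuous hf hc)
  refine ⟨fun x => ?_⟩
  rw [StieltjesFunction.measure_singleton, h,
    hc.continuousAt.continuousWithinAt.leftLim_eq, sub_self, ENNReal.ofReal_zero]

theorem totalVarMeasure_Ioc (hφ : BoundedVariationOn φ (Icc 0 T)) (hT : 0 ≤ T)
    (hφc : ContinuousOn φ (Icc 0 T)) (s t : ℝ) :
    totalVarMeasure hφ (Ioc s t) = ENNReal.ofReal (totalVar T φ t - totalVar T φ s) :=
  stieltjesFunction_measure_Ioc _ (continuous_totalVar hφ hT hφc) s t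

theorem isFiniteMeasure_totalVarMeasure (hφ : BoundedVariationOn φ (Icc 0 T)) (hT : 0 ≤ T)
    (hφc : ContinuousOn φ (Icc 0 T)) : IsFiniteMeasure (totalVarMeasure hφ) := by
  refine StieltjesFunction.isFiniteMeasure_of_forall_abs_le (C := (eVariationOn φ (Icc 0 T)).toReal)
    _ fun x => ?_
  rw [stieltjesFunction_eq_of_continuous _ (continuous_totalVar hφ hT hφc), totalVar,
    ENNReal.abs_toReal]
  exact ENNReal.toReal_mono hφ (eVariationOn.mono _ (Icc_subset_Icc_right (min_le_right _ _)))

end TotalVariation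

/-! ### The driving measure and the driven path -/

section DrivenPath

open Filter Topology

variable {E F : Type*} [NormedAddCommGroup E] [NormedSpace ℝ E]
  [NormedAddCommGroup F] [NormedSpace ℝ F] [CompleteSpace F] {T : ℝ} {w : ℝ → F}

theorem pathMeasure_Ioc {F : Type*} [NormedAddCommGroup F] [CompleteSpace F] {w : ℝ → F}
    (hw : BoundedVariationOn w (Icc 0 T)) (hT : 0 ≤ T)
    (hwc : ContinuousOn w (Icc 0 T)) {s t : ℝ} (hst : s ≤ t) :
    pathMeasure hw (Ioc s t) = clamp T w t - clamp T w s := by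
  have hc := continuous_clamp hT hwc
  rw [pathMeasure, BoundedVariationOn.vectorMeasure_Ioc _ hst,
    hc.continuousAt.continuousWithinAt.rightLim_eq, hc.continuousAt.continuousWithinAt.rightLim_eq]

/-- Half-open intervals form a generating π-system; the whole line is not one of them and is reached
by exhaustion. -/
theorem vectorMeasure_eq_of_Ioc {F : Type*} [NormedAddCommGroup F] {μ ν : VectorMeasure ℝ F}
    (h : ∀ s t : ℝ, s ≤ t → μ (Ioc s t) = ν (Ioc s t)) : μ = ν := by
  refine VectorMeasure.ext_of_generateFrom {S | ∃ u v : ℝ, u ≤ v ∧ Ioc u v = S} ?_ ?_ ?_ ?_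
  · rintro _ ⟨s, t, hst, rfl⟩
    exact h s t hst
  · rw [BorelSpace.measurable_eq (α := ℝ)]
    convert! borel_eq_generateFrom_Ioc_le ℝ using 2
  · rintro _ ⟨a, b, -, rfl⟩ _ ⟨c, d, -, rfl⟩ hne
    rw [Ioc_inter_Ioc] at hne ⊢
    exact ⟨_, _, (nonempty_Ioc.1 hne).le, rfl⟩
  · have hU : (univ : Set ℝ) = ⋃ n : ℕ, Ioc (-(n : ℝ)) n := by
      refine (eq_univ_of_forall fun x => mem_iUnion.2 ?_).symm
      obtain ⟨n, hn⟩ := exists_nat_gt |x|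
      exact ⟨n, (abs_lt.1 hn).1, (abs_lt.1 hn).2.le⟩
    have hm : Monotone fun n : ℕ => Ioc (-(n : ℝ)) n := fun m n hmn =>
      Ioc_subset_Ioc (neg_le_neg (by exact_mod_cast hmn)) (by exact_mod_cast hmn)
    have h1 := μ.tendsto_vectorMeasure_iUnion_atTop_nat hm fun _ => measurableSet_Ioc
    have h2 := ν.tendsto_vectorMeasure_iUnion_atTop_nat hm fun _ => measurableSet_Ioc
    rw [← hU] at h1 h2
    refine tendsto_nhds_unique h1 (h2.congr fun n => (h _ _ ?_).symm)
    have : (0 : ℝ) ≤ n := Nat.cast_nonneg n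
    linarith

/-- The increments of `w` are dominated by `d‖w‖` on intervals. The extension theorem yields a
vector measure with these increments, dominated on all measurable sets, and it must be `dw`. -/
theorem variation_pathMeasure_le {F : Type*} [NormedAddCommGroup F] [CompleteSpace F] {w : ℝ → F}
    (hw : BoundedVariationOn w (Icc 0 T)) (hT : 0 ≤ T)
    (hwc : ContinuousOn w (Icc 0 T)) : (pathMeasure hw).variation ≤ totalVarMeasure hw := by
  have := isFiniteMeasure_totalVarMeasure hw hT hwc
  obtain ⟨m, hm, hle⟩ :=
    VectorMeasure.exists_extension_of_isSetSemiring_of_le_measure_of_generateFrom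
      (μ := totalVarMeasure hw) (m := AddContent.onIoc (clamp T w)) IsSetSemiring.Ioc
      (by
        rintro _ ⟨u, v, huv, rfl⟩
        rw [AddContent.onIoc_apply huv, totalVarMeasure_Ioc hw hT hwc, ← ofReal_norm]
        exact ENNReal.ofReal_le_ofReal (norm_clamp_sub_le_totalVar_sub hw hT huv))
      (by
        rw [BorelSpace.measurable_eq (α := ℝ)]
        convert! borel_eq_generateFrom_Ioc_le ℝ using 2
        grind only)
  have heq : pathMeasure hw = m := vectorMeasure_eq_of_Ioc fun s t hst => by
    rw [pathMeasure_Ioc hw hT hwc hst, hm _ ⟨s, t, hst, rfl⟩, AddContent.onIoc_apply hst]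
  rw [heq]
  exact VectorMeasure.variation_le_of_forall_enorm_le fun S _ => hle S

/-- The control of the driver: total variation of `w` plus time. -/
noncomputable def driverControl {F : Type*} [NormedAddCommGroup F] (T : ℝ) (w : ℝ → F) (t : ℝ) :
    ℝ :=
  totalVar T w t + t

theorem drivenPath_zero (σ : E → F →L[ℝ] E) (b : E → E) (hw : BoundedVariationOn w (Icc 0 T))
    (x₀ : E) (x : ℝ → E) : drivenPath σ b hw x₀ x 0 = x₀ := by
  simp [drivenPath]

/-- Increments of the driven path, compared with those of frozen coefficients. -/
theorem norm_drivenPath_sub_le [CompleteSpace E] {σ : E → F →L[ℝ] E} {b : E → E}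
    (hσ : Continuous σ) (hb : Continuous b) (hw : BoundedVariationOn w (Icc 0 T)) (hT : 0 ≤ T)
    (hwc : ContinuousOn w (Icc 0 T)) (x₀ : E) {x : ℝ → E} (hx : ContinuousOn x (Icc 0 T))
    {s t : ℝ} (hs : 0 ≤ s) (hst : s ≤ t) (ht : t ≤ T) {A : F →L[ℝ] E} {v : E} {ρ : ℝ}
    (hA : ∀ r ∈ Icc s t, ‖σ (x r) - A‖ ≤ ρ) (hv : ∀ r ∈ Icc s t, ‖b (x r) - v‖ ≤ ρ) :
    ‖drivenPath σ b hw x₀ x t - drivenPath σ b hw x₀ x s - A (w t - w s) - (t - s) • v‖ ≤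
      ρ * (driverControl T w t - driverControl T w s) := by
  have hρ : 0 ≤ ρ := (norm_nonneg _).trans (hA s ⟨le_rfl, hst⟩)
  have hfin := isFiniteMeasure_totalVarMeasure hw hT hwc
  have hvar := variation_pathMeasure_le hw hT hwc
  have hfin' : IsFiniteMeasure (pathMeasure hw).variation := isFiniteMeasure_of_le _ hvar
  have hσx : ContinuousOn (fun r => σ (x r)) (Icc 0 T) := hσ.comp_continuousOn hx
  have hbx : ContinuousOn (fun r => b (x r)) (Icc 0 T) := hb.comp_continuousOn hx
  have hf_int : ∀ a c, 0 ≤ a → c ≤ T →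
      (pathMeasure hw).IntegrableOn (fun r => σ (x r)) (Ioc a c) := by
    intro a c ha hc
    rw [VectorMeasure.IntegrableOn, VectorMeasure.Integrable,
      VectorMeasure.variation_restrict measurableSet_Ioc]
    exact (hσx.integrableOn_Icc (μ := (pathMeasure hw).variation)).mono_set
      (Ioc_subset_Icc_self.trans (Icc_subset_Icc ha hc))
  have hbi : ∀ a c, 0 ≤ a → a ≤ c → c ≤ T → IntervalIntegrable (fun r => b (x r)) volume a c :=
    fun a c ha hac hc => (hbx.mono (Icc_subset_Icc ha hc)).intervalIntegrable_of_Icc hac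
  have hsplit : drivenPath σ b hw x₀ x t - drivenPath σ b hw x₀ x s =
      (∫ᵛ r in Ioc s t, σ (x r) ∂[ContinuousLinearMap.id ℝ (F →L[ℝ] E); pathMeasure hw]) +
        ∫ r in s..t, b (x r) := by
    have h1 := VectorMeasure.setIntegral_union (μ := pathMeasure hw)
      (B := ContinuousLinearMap.id ℝ (F →L[ℝ] E)) (f := fun r => σ (x r))
      (Ioc_disjoint_Ioc_of_le (a := 0) (d := t) (le_refl s)) measurableSet_Ioc measurableSet_Ioc
      (hf_int 0 s le_rfl (hst.trans ht)) (hf_int s t hs ht)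
    rw [Ioc_union_Ioc_eq_Ioc hs hst] at h1
    have h2 := intervalIntegral.integral_add_adjacent_intervals
      (hbi 0 s le_rfl hs (hst.trans ht)) (hbi s t hs hst ht)
    rw [drivenPath, drivenPath, h1, ← h2]
    abel
  have hσA : (∫ᵛ r in Ioc s t, σ (x r) ∂[ContinuousLinearMap.id ℝ (F →L[ℝ] E); pathMeasure hw]) -
      A (w t - w s) =
      ∫ᵛ r in Ioc s t, (σ (x r) - A) ∂[ContinuousLinearMap.id ℝ (F →L[ℝ] E); pathMeasure hw] := by
    have hAint : (pathMeasure hw).IntegrableOn (fun _ => A) (Ioc s t) := by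
      rw [VectorMeasure.IntegrableOn, VectorMeasure.Integrable,
        VectorMeasure.variation_restrict measurableSet_Ioc]
      exact integrable_const A
    rw [VectorMeasure.integral_fun_sub (hf_int s t hs ht) hAint, VectorMeasure.setIntegral_const,
      pathMeasure_Ioc hw hT hwc hst, clamp_of_mem ⟨hs, hst.trans ht⟩,
      clamp_of_mem ⟨hs.trans hst, ht⟩]
    rfl
  have hbv : (∫ r in s..t, b (x r)) - (t - s) • v = ∫ r in s..t, (b (x r) - v) := by
    rw [intervalIntegral.integral_sub (hbi s t hs hst ht) intervalIntegrable_const,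
      intervalIntegral.integral_const]
  have hn1 : ‖∫ᵛ r in Ioc s t, (σ (x r) - A)
      ∂[ContinuousLinearMap.id ℝ (F →L[ℝ] E); pathMeasure hw]‖ ≤
      ρ * (totalVar T w t - totalVar T w s) := by
    refine (VectorMeasure.norm_setIntegral_le_of_norm_le_const fun r hr =>
      hA r (Ioc_subset_Icc_self hr)).trans ?_
    have h1 : ‖ContinuousLinearMap.id ℝ (F →L[ℝ] E)‖ ≤ 1 := ContinuousLinearMap.norm_id_le
    have h2 : (pathMeasure hw).variation.real (Ioc s t) ≤ totalVar T w t - totalVar T w s := by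
      refine ENNReal.toReal_le_of_le_ofReal
        (sub_nonneg.2 (totalVar_mono hw hst)) ?_
      rw [← totalVarMeasure_Ioc hw hT hwc]
      exact hvar _
    calc _ ≤ ρ * 1 * (totalVar T w t - totalVar T w s) := by gcongr
      _ = _ := by ring
  have hn2 : ‖∫ r in s..t, (b (x r) - v)‖ ≤ ρ * (t - s) := by
    have := intervalIntegral.norm_integral_le_of_norm_le_const (a := s) (b := t)
      (f := fun r => b (x r) - v) (C := ρ) fun r hr => by
        rw [uIoc_of_le hst] at hr
        exact hv r (Ioc_subset_Icc_self hr)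
    rwa [abs_of_nonneg (sub_nonneg.2 hst)] at this
  rw [hsplit]
  calc _ = ‖((∫ᵛ r in Ioc s t, σ (x r)
        ∂[ContinuousLinearMap.id ℝ (F →L[ℝ] E); pathMeasure hw]) - A (w t - w s)) +
        ((∫ r in s..t, b (x r)) - (t - s) • v)‖ := by congr 1; abel
    _ ≤ _ := norm_add_le _ _
    _ ≤ _ := by
      rw [hσA, hbv, driverControl, driverControl]
      linarith

end DrivenPath

/-! ### Differentiation with respect to a continuous monotone function -/

section Differentiation

open Filter Topology

/-- A path whose increments are dominated by those of `H` has variation at most that of `H`. -/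
theorem eVariationOn_Icc_le_of_norm_sub_le {E : Type*} [NormedAddCommGroup E] {f : ℝ → E}
    {H : ℝ → ℝ} {a b : ℝ} (hab : a ≤ b)
    (h : ∀ s ∈ Icc a b, ∀ t ∈ Icc a b, s ≤ t → ‖f t - f s‖ ≤ H t - H s) :
    eVariationOn f (Icc a b) ≤ ENNReal.ofReal (H b - H a) := by
  have hH : MonotoneOn H (Icc a b) := fun s hs t ht hst =>
    sub_nonneg.1 ((norm_nonneg _).trans (h s hs t ht hst))
  have h1 := (hH.eVariationOn_eq (left_mem_Icc.2 hab) (right_mem_Icc.2 hab)).le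
  rw [inter_self] at h1
  refine le_trans (iSup_mono fun p => Finset.sum_le_sum fun i _ => ?_) h1
  have hm := p.2.2.1 (Nat.le_succ i)
  rw [edist_dist, edist_dist, dist_eq_norm, Real.dist_eq]
  exact ENNReal.ofReal_le_ofReal ((h _ (p.2.2.2 i) _ (p.2.2.2 (i + 1)) hm).trans (le_abs_self _))

variable {A f : ℝ → ℝ}

/-- Differentiation of one Lebesgue–Stieltjes measure with respect to another one. -/
theorem ae_tendsto_slope_stieltjes (hA : Monotone A) (hAc : Continuous A) (hf : Monotone f)
    (hfc : Continuous f) :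
    ∀ᵐ s ∂hA.stieltjesFunction.measure,
      Tendsto (fun r => (f (s + r) - f (s - r)) / (A (s + r) - A (s - r))) (𝓝[>] 0)
        (𝓝 (hf.stieltjesFunction.measure.rnDeriv hA.stieltjesFunction.measure s).toReal) := by
  have hball : ∀ {g : ℝ → ℝ} (hg : Monotone g), Continuous g → ∀ s r, 0 < r →
      (hg.stieltjesFunction.measure (Metric.closedBall s r)).toReal = g (s + r) - g (s - r) := by
    intro g hg hgc s r hr
    have := noAtoms_stieltjesFunction_measure hg hgc
    rw [Real.closedBall_eq_Icc, ← measure_congr Ioc_ae_eq_Icc, stieltjesFunction_measure_Ioc hg hgc,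
      ENNReal.toReal_ofReal (sub_nonneg.2 (hg (by linarith)))]
  -- Closed balls are centred intervals, hence the symmetric slopes. Absolute continuity of `df` is
  -- not required, and the limit is finite almost everywhere.
  filter_upwards [Besicovitch.ae_tendsto_rnDeriv hf.stieltjesFunction.measure
    hA.stieltjesFunction.measure, Measure.rnDeriv_lt_top hf.stieltjesFunction.measure
    hA.stieltjesFunction.measure] with s hs hlt
  refine ((ENNReal.tendsto_toReal hlt.ne).comp hs).congr' ?_
  filter_upwards [self_mem_nhdsWithin] with r hr
  rw [Function.comp, ENNReal.toReal_div, hball hf hfc s r hr, hball hA hAc s r hr]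

/-- A real function dominated by a continuous monotone function `A` has a density with respect to
`dA`, which is almost everywhere the limit of its slopes. -/
theorem exists_density_of_abs_sub_le (hA : Monotone A) (hAc : Continuous A)
    [IsFiniteMeasure hA.stieltjesFunction.measure] (hfc : Continuous f)
    (hfA : ∀ s t, s ≤ t → |f t - f s| ≤ A t - A s) :
    ∃ g : ℝ → ℝ, Measurable g ∧ Integrable g hA.stieltjesFunction.measure ∧
      (∀ s t, s ≤ t → f t - f s = ∫ r in Ioc s t, g r ∂hA.stieltjesFunction.measure) ∧
      ∀ᵐ s ∂hA.stieltjesFunction.measure,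
        Tendsto (fun r => (f (s + r) - f (s - r)) / (A (s + r) - A (s - r))) (𝓝[>] 0)
          (𝓝 (g s)) := by
  -- Both `A + f` and `A - f` are monotone and their measures add up to `2 dA`. So `d(f + A)` is
  -- absolutely continuous, and its density minus one is that of `f`.
  have hB : Monotone fun t => f t + A t := fun s t hst => by
    have := (abs_le.1 (hfA s t hst)).1
    change f s + A s ≤ f t + A t
    linarith
  have hB' : Monotone fun t => A t - f t := fun s t hst => by
    have := (abs_le.1 (hfA s t hst)).2
    change A s - f s ≤ A t - f t
    linarith
  have hBc : Continuous fun t => f t + A t := hfc.add hAc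
  have hBc' : Continuous fun t => A t - f t := hAc.sub hfc
  set μ := hA.stieltjesFunction.measure with hμ
  set ρ := hB.stieltjesFunction.measure with hρ
  have hsum : ρ + hB'.stieltjesFunction.measure = μ + μ := by
    rw [hρ, hμ, ← StieltjesFunction.measure_add, ← StieltjesFunction.measure_add]
    congr 1
    ext t
    simp only [StieltjesFunction.add_apply, stieltjesFunction_eq_of_continuous hB hBc,
      stieltjesFunction_eq_of_continuous hB' hBc', stieltjesFunction_eq_of_continuous hA hAc]
    ring
  have hle : ρ ≤ μ + μ := hsum ▸ Measure.le_add_right le_rfl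
  have hac : ρ ≪ μ := by
    refine Measure.AbsolutelyContinuous.mk fun S _ h0 => le_antisymm ((hle S).trans ?_) zero_le
    simp [h0]
  have : IsFiniteMeasure ρ := isFiniteMeasure_of_le _ hle
  have hf_int : Integrable (fun s => (ρ.rnDeriv μ s).toReal) μ := Measure.integrable_toReal_rnDeriv
  refine ⟨fun s => (ρ.rnDeriv μ s).toReal - 1,
    (Measure.measurable_rnDeriv _ _).ennreal_toReal.sub_const _,
    hf_int.sub (integrable_const 1), fun s t hst => ?_, ?_⟩
  · rw [integral_sub hf_int.integrableOn (integrable_const 1), Measure.setIntegral_toReal_rnDeriv hac,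
      setIntegral_const, smul_eq_mul, mul_one, measureReal_def, measureReal_def,
      stieltjesFunction_measure_Ioc hA hAc, stieltjesFunction_measure_Ioc hB hBc,
      ENNReal.toReal_ofReal (sub_nonneg.2 (hA hst)), ENNReal.toReal_ofReal (sub_nonneg.2 (hB hst))]
    ring
  · filter_upwards [ae_tendsto_slope_stieltjes hA hAc hB hBc,
      ae_tendsto_slope_stieltjes hA hAc hA hAc, Measure.rnDeriv_self μ] with s h1 h2 h3
    rw [← hμ, h3, ENNReal.toReal_one] at h2
    refine (h1.sub h2).congr fun r => ?_
    rw [← sub_div]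
    congr 1
    ring

variable {E : Type*} [NormedAddCommGroup E] [InnerProductSpace ℝ E] [FiniteDimensional ℝ E]

/-- The vector-valued version of `exists_density_of_abs_sub_le`. -/
theorem exists_density_of_norm_sub_le (hA : Monotone A) (hAc : Continuous A)
    [IsFiniteMeasure hA.stieltjesFunction.measure] {φ : ℝ → E} (hφc : Continuous φ)
    (hφA : ∀ s t, s ≤ t → ‖φ t - φ s‖ ≤ A t - A s) :
    ∃ n : ℝ → E, StronglyMeasurable n ∧ Integrable n hA.stieltjesFunction.measure ∧
      (∀ s t, s ≤ t → φ t - φ s = ∫ r in Ioc s t, n r ∂hA.stieltjesFunction.measure) ∧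
      ∀ᵐ s ∂hA.stieltjesFunction.measure,
        Tendsto (fun r => (A (s + r) - A (s - r))⁻¹ • (φ (s + r) - φ (s - r))) (𝓝[>] 0)
          (𝓝 (n s)) := by
  let e := stdOrthonormalBasis ℝ E
  have hcoord : ∀ i, Continuous fun t => inner ℝ (e i) (φ t) := fun i => by fun_prop
  choose g hgm hgi hg hgs using fun i => exists_density_of_abs_sub_le hA hAc (hcoord i)
    fun s t hst => by
      rw [← inner_sub_right]
      refine (abs_real_inner_le_norm _ _).trans ?_
      rw [e.norm_eq_one, one_mul]
      exact hφA s t hst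
  have hrepr : ∀ v : E, v = ∑ i, inner ℝ (e i) v • e i := fun v => (e.sum_repr' v).symm
  have hterm : ∀ i, Integrable (fun s => g i s • e i) hA.stieltjesFunction.measure :=
    fun i => (hgi i).smul_const _
  refine ⟨fun s => ∑ i, g i s • e i, ?_, integrable_finsetSum _ fun i _ => hterm i,
    fun s t hst => ?_, ?_⟩
  · exact Finset.stronglyMeasurable_fun_sum _ fun i _ => (hgm i).stronglyMeasurable.smul_const _
  · rw [integral_finsetSum _ fun i _ => (hterm i).integrableOn]
    simp only [integral_smul_const, ← hg _ s t hst, ← inner_sub_right]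
    exact hrepr _
  · filter_upwards [ae_all_iff.2 hgs] with s hs
    refine (tendsto_finsetSum _ fun i _ => (hs i).smul_const (e i)).congr fun r => ?_
    rw [hrepr (φ (s + r) - φ (s - r)), Finset.smul_sum]
    refine Finset.sum_congr rfl fun i _ => ?_
    rw [smul_smul, ← inner_sub_right, div_eq_inv_mul]

/-- **Polar decomposition** of a continuous path of bounded variation: it is the integral against
its total variation of a density of norm one, which is the limit of its slopes. -/
theorem exists_polar_density {T : ℝ} (hT : 0 ≤ T) {φ : ℝ → E}
    (hφ : BoundedVariationOn φ (Icc 0 T)) (hφc : ContinuousOn φ (Icc 0 T)) :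
    ∃ n : ℝ → E, StronglyMeasurable n ∧
      (∀ t ∈ Icc 0 T, φ t - φ 0 = ∫ r in Ioc 0 t, n r ∂totalVarMeasure hφ) ∧
      ∀ᵐ s ∂(totalVarMeasure hφ).restrict (Ioc 0 T), ‖n s‖ = 1 ∧
        Tendsto (fun r => (totalVar T φ (s + r) - totalVar T φ (s - r))⁻¹ •
          (clamp T φ (s + r) - clamp T φ (s - r))) (𝓝[>] 0) (𝓝 (n s)) := by
  have hA := totalVar_mono hφ
  have hAc := continuous_totalVar hφ hT hφc
  have hfin : IsFiniteMeasure hA.stieltjesFunction.measure :=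
    isFiniteMeasure_totalVarMeasure hφ hT hφc
  obtain ⟨n, hnm, hni, hn, hns⟩ := exists_density_of_norm_sub_le hA hAc (continuous_clamp hT hφc)
    fun s t hst => norm_clamp_sub_le_totalVar_sub hφ hT hst
  change ∀ᵐ s ∂totalVarMeasure hφ, _ at hns
  change Integrable n (totalVarMeasure hφ) at hni
  change ∀ s t, s ≤ t → _ = ∫ r in Ioc s t, n r ∂totalVarMeasure hφ at hn
  change IsFiniteMeasure (totalVarMeasure hφ) at hfin
  have h0 : (0 : ℝ) ∈ Icc 0 T := ⟨le_rfl, hT⟩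
  have hle : ∀ᵐ s ∂totalVarMeasure hφ, ‖n s‖ ≤ 1 := by
    filter_upwards [hns] with s hs
    refine le_of_tendsto hs.norm ?_
    filter_upwards [self_mem_nhdsWithin] with r hr
    have hr' : s - r ≤ s + r := by have : 0 < r := hr; linarith
    have h1 := norm_clamp_sub_le_totalVar_sub hφ hT hr'
    have h2 : 0 ≤ totalVar T φ (s + r) - totalVar T φ (s - r) := (norm_nonneg _).trans h1
    rw [norm_smul, norm_inv, Real.norm_eq_abs, abs_of_nonneg h2, ← div_eq_inv_mul]
    exact div_le_one_of_le₀ h1 h2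
  -- Since `‖n‖ ≤ 1` and `d‖φ‖` has total mass `totalVar T φ T`, this reverse bound forces `‖n‖ = 1`
  -- almost everywhere.
  have hvar : totalVar T φ T ≤ ∫ s in Ioc 0 T, ‖n s‖ ∂totalVarMeasure hφ := by
    have h1 := eVariationOn_Icc_le_of_norm_sub_le (f := φ)
      (H := fun t => ∫ s in Ioc 0 t, ‖n s‖ ∂totalVarMeasure hφ) hT fun s hs t ht hst => by
        have h2 : φ t - φ s = ∫ r in Ioc s t, n r ∂totalVarMeasure hφ := by
          rw [← hn s t hst, clamp_of_mem hs, clamp_of_mem ht]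
        have h3 : (∫ r in Ioc 0 t, ‖n r‖ ∂totalVarMeasure hφ) -
            ∫ r in Ioc 0 s, ‖n r‖ ∂totalVarMeasure hφ =
            ∫ r in Ioc s t, ‖n r‖ ∂totalVarMeasure hφ := by
          rw [← Ioc_union_Ioc_eq_Ioc hs.1 hst, setIntegral_union
            (Ioc_disjoint_Ioc_of_le le_rfl) measurableSet_Ioc hni.norm.integrableOn
            hni.norm.integrableOn, add_sub_cancel_left]
        rw [h2, h3]
        exact norm_integral_le_integral_norm _
    have h4 : ∫ s in Ioc 0 0, ‖n s‖ ∂totalVarMeasure hφ = 0 := by simp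
    simp only [h4, sub_zero] at h1
    rw [totalVar, min_self]
    exact ENNReal.toReal_le_of_le_ofReal (integral_nonneg fun _ => norm_nonneg _) h1
  have hone : ∀ᵐ s ∂(totalVarMeasure hφ).restrict (Ioc 0 T), ‖n s‖ = 1 := by
    have h1 : 0 ≤ᵐ[(totalVarMeasure hφ).restrict (Ioc 0 T)] fun s => 1 - ‖n s‖ :=
      ae_restrict_of_ae (hle.mono fun s hs => sub_nonneg.2 hs)
    have h2 : ∫ s in Ioc 0 T, (1 - ‖n s‖) ∂totalVarMeasure hφ = 0 := by
      refine le_antisymm ?_ (integral_nonneg_of_ae h1)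
      rw [integral_sub (integrable_const 1) hni.norm.integrableOn, setIntegral_const, smul_eq_mul,
        mul_one, measureReal_def, totalVarMeasure_Ioc hφ hT hφc, totalVar_zero, sub_zero,
        ENNReal.toReal_ofReal (show 0 ≤ totalVar T φ T from ENNReal.toReal_nonneg)]
      linarith
    have h3 := (integral_eq_zero_iff_of_nonneg_ae h1
      ((integrable_const 1).sub hni.norm.integrableOn)).1 h2
    filter_upwards [h3] with s hs
    exact (sub_eq_zero.1 hs).symm
  refine ⟨n, hnm, fun t ht => ?_, ?_⟩
  · rw [← hn 0 t ht.1, clamp_of_mem ht, clamp_of_mem h0]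
  · filter_upwards [hone, ae_restrict_of_ae hns] with s h1 h2 using ⟨h1, h2⟩

end Differentiation

/-! ### Solutions and increment solutions -/

section Equivalence

open Filter Topology

variable {E F : Type*} [NormedAddCommGroup E] [InnerProductSpace ℝ E]
  [NormedAddCommGroup F] [NormedSpace ℝ F] {D : Set E} {σ : E → F →L[ℝ] E}
  {b : E → E} {T : ℝ} {w : ℝ → F} {x₀ : E} {x x' φ : ℝ → E}

theorem continuous_driverControl {F : Type*} [NormedAddCommGroup F] {w : ℝ → F}
    (hw : BoundedVariationOn w (Icc 0 T)) (hT : 0 ≤ T)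
    (hwc : ContinuousOn w (Icc 0 T)) : Continuous (driverControl T w) :=
  (continuous_totalVar hw hT hwc).add continuous_id

theorem monotone_driverControl {F : Type*} [NormedAddCommGroup F] {w : ℝ → F}
    (hw : BoundedVariationOn w (Icc 0 T)) : Monotone (driverControl T w) :=
  (totalVar_mono hw).add monotone_id

theorem norm_clamp_sub_add_le_driverControl {F : Type*} [NormedAddCommGroup F] {w : ℝ → F}
    (hw : BoundedVariationOn w (Icc 0 T)) (hT : 0 ≤ T) (s t : ℝ) (hst : s ≤ t) :
    ‖clamp T w t - clamp T w s‖ + (t - s) ≤ driverControl T w t - driverControl T w s := by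
  have := norm_clamp_sub_le_totalVar_sub hw hT hst
  rw [driverControl, driverControl]
  linarith

theorem norm_sub_add_le_driverControl {F : Type*} [NormedAddCommGroup F] {w : ℝ → F}
    (hw : BoundedVariationOn w (Icc 0 T)) {s t : ℝ}
    (hs : s ∈ Icc 0 T) (ht : t ∈ Icc 0 T) (hst : s ≤ t) :
    ‖w t - w s‖ + (t - s) ≤ driverControl T w t - driverControl T w s := by
  have := norm_clamp_sub_add_le_driverControl hw (hs.1.trans hs.2) s t hst
  rwa [clamp_of_mem hs, clamp_of_mem ht] at this

theorem drivenPath_congr [CompleteSpace F] {E : Type*} [NormedAddCommGroup E] [NormedSpace ℝ E]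
    {σ : E → F →L[ℝ] E} {b : E → E} {x₀ : E} {x x' : ℝ → E}
    (hw : BoundedVariationOn w (Icc 0 T)) (h : EqOn x x' (Icc 0 T)) {t : ℝ} (ht : t ∈ Icc 0 T) :
    drivenPath σ b hw x₀ x t = drivenPath σ b hw x₀ x' t := by
  rw [drivenPath, drivenPath]
  congr 1
  · congr 1
    refine VectorMeasure.setIntegral_congr_fun fun r hr => ?_
    change σ (x r) = σ (x' r)
    rw [h ⟨hr.1.le, hr.2.trans ht.2⟩]
  · refine intervalIntegral.integral_congr fun r hr => ?_
    rw [uIcc_of_le ht.1] at hr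
    rw [h ⟨hr.1, hr.2.trans ht.2⟩]

theorem continuousOn_of_norm_sub_le {E : Type*} [NormedAddCommGroup E] {f : ℝ → E} {V : ℝ → ℝ}
    {C : ℝ} {S : Set ℝ} (hV : ContinuousOn V S)
    (h : ∀ s ∈ S, ∀ t ∈ S, s ≤ t → ‖f t - f s‖ ≤ C * (V t - V s)) : ContinuousOn f S := by
  intro s hs
  have hlim : Tendsto (fun t => |C * (V t - V s)|) (𝓝[S] s) (𝓝 0) := by
    have := (((hV s hs).sub_const (V s)).const_mul C).abs
    rwa [sub_self, mul_zero, abs_zero] at this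
  refine tendsto_iff_norm_sub_tendsto_zero.2 (squeeze_zero' (Eventually.of_forall fun _ =>
    norm_nonneg _) ?_ hlim)
  filter_upwards [self_mem_nhdsWithin] with t ht
  rcases le_total s t with hst | hst
  · exact (h s hs t ht hst).trans (le_abs_self _)
  · rw [norm_sub_rev, ← abs_neg, ← mul_neg, neg_sub]
    exact (h t ht s hs hst).trans (le_abs_self _)

theorem boundedVariationOn_of_norm_sub_le {E : Type*} [NormedAddCommGroup E] {f : ℝ → E}
    {V : ℝ → ℝ} {C : ℝ} (hT : 0 ≤ T)
    (h : ∀ s ∈ Icc 0 T, ∀ t ∈ Icc 0 T, s ≤ t → ‖f t - f s‖ ≤ C * (V t - V s)) :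
    BoundedVariationOn f (Icc 0 T) :=
  ne_top_of_le_ne_top ENNReal.ofReal_ne_top <|
    eVariationOn_Icc_le_of_norm_sub_le (H := fun t => C * V t) hT fun s hs t ht hst => by
      rw [← mul_sub]
      exact h s hs t ht hst

/-- At time `T`, `variation_eq` equates the full finite mass of `d‖φ‖` with the mass of the frontier
times, so the complement is null. -/
theorem IsSkorohodSolution.ae_mem_frontier {y : ℝ → E} (h : IsSkorohodSolution D T y x φ)
    (hT : 0 ≤ T) :
    ∀ᵐ s ∂(totalVarMeasure h.boundedVariation).restrict (Ioc 0 T), x s ∈ frontier D := by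
  have hfin := isFiniteMeasure_totalVarMeasure h.boundedVariation hT h.continuousOn_reflection
  set μ := totalVarMeasure h.boundedVariation with hμ
  set Z := Icc 0 T ∩ x ⁻¹' frontier D with hZ
  have hZm : MeasurableSet Z :=
    (h.continuousOn_path.preimage_isClosed_of_isClosed isClosed_Icc isClosed_frontier).measurableSet
  have h1 : ∫ s in Ioc 0 T, (frontier D).indicator (fun _ => (1 : ℝ)) (x s) ∂μ =
      ∫ s in Ioc 0 T, Z.indicator (fun _ => (1 : ℝ)) s ∂μ := by
    refine setIntegral_congr_fun measurableSet_Ioc fun s hs => ?_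
    have hs' : s ∈ Icc 0 T := Ioc_subset_Icc_self hs
    by_cases hxs : x s ∈ frontier D
    · have : s ∈ Z := ⟨hs', hxs⟩
      simp [hxs, this]
    · have : s ∉ Z := fun hz => hxs hz.2
      simp [hxs, this]
  have h2 := h.variation_eq T ⟨hT, le_rfl⟩
  rw [h1, setIntegral_indicator hZm, setIntegral_const, smul_eq_mul, mul_one] at h2
  have h3 : μ (Ioc 0 T) = μ (Ioc 0 T ∩ Z) := by
    rw [hμ, totalVarMeasure_Ioc h.boundedVariation hT h.continuousOn_reflection, totalVar_zero,
      sub_zero, h2, measureReal_def, ENNReal.ofReal_toReal (measure_ne_top _ _)]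
  have h4 : μ (Ioc 0 T \ Z) = 0 := by
    rw [← sdiff_inter_self_eq_sdiff, inter_comm, measure_sdiff inter_subset_left
      (measurableSet_Ioc.inter hZm).nullMeasurableSet (measure_ne_top _ _), h3, tsub_self]
  rw [ae_restrict_iff' measurableSet_Ioc]
  refine measure_mono_null (fun s hs => ?_) h4
  simp only [mem_compl_iff, mem_ofPred_eq, Classical.not_imp] at hs
  exact ⟨hs.1, fun hz => hs.2 hz.2⟩

/-- At a point where the slopes of `φ` have a limit `n` of norm one, and the slopes of the control
have a finite limit, the path is on the frontier and `n` is a normal. -/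
theorem IsIncrementSolution.mem_frontier_and_mem_normals {V A : ℝ → ℝ} {C κ : ℝ}
    (h : IsIncrementSolution D σ b (Icc 0 T) w id V C x φ) (hD : IsOpen D) (hA : Monotone A)
    (hV : Continuous V) (hxc : ContinuousOn x (Icc 0 T)) {s : ℝ} (hs : s ∈ Ioo 0 T) {n : E}
    (hn : ‖n‖ = 1)
    (hnlim : Tendsto (fun r => (A (s + r) - A (s - r))⁻¹ • (φ (s + r) - φ (s - r))) (𝓝[>] 0)
      (𝓝 n))
    (hκ : Tendsto (fun r => (V (s + r) - V (s - r)) / (A (s + r) - A (s - r))) (𝓝[>] 0) (𝓝 κ)) :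
    x s ∈ frontier D ∧ n ∈ normals D (x s) := by
  have hsI : s ∈ Icc 0 T := Ioo_subset_Icc_self hs
  have hleft : Tendsto (fun r : ℝ => s - r) (𝓝[>] 0) (𝓝 s) := by
    have : Continuous fun r : ℝ => s - r := by fun_prop
    simpa using (this.tendsto 0).mono_left nhdsWithin_le_nhds
  have hright : Tendsto (fun r : ℝ => s + r) (𝓝[>] 0) (𝓝 s) := by
    have : Continuous fun r : ℝ => s + r := by fun_prop
    simpa using (this.tendsto 0).mono_left nhdsWithin_le_nhds
  have hxat : ContinuousAt x s := hxc.continuousAt (Icc_mem_nhds hs.1 hs.2)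
  have hxl : Tendsto (fun r => x (s - r)) (𝓝[>] 0) (𝓝 (x s)) := hxat.tendsto.comp hleft
  have hVd : Tendsto (fun r => V (s + r) - V (s - r)) (𝓝[>] 0) (𝓝 0) := by
    simpa using ((hV.tendsto s).comp hright).sub ((hV.tendsto s).comp hleft)
  -- Divide the variational inequality on `[s - r, s + r]` by the increment of `A` and let `r → 0`:
  -- the second-order terms keep a vanishing factor, and the curvature term tends to `C κ ‖z - x
  -- s‖²`.
  have key : ∀ z ∈ closure D, 0 ≤ inner ℝ (z - x s) n + C * κ * ‖z - x s‖ ^ 2 := by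
    intro z hz
    have hzl := (tendsto_const_nhds (x := z)).sub hxl
    have hL := (((hzl.norm.pow 2).add (((hzl.norm.const_add 1).add hVd).mul hVd)).const_mul
      C).mul hκ |>.neg
    have hR := hzl.inner hnlim (𝕜 := ℝ)
    have hle := le_of_tendsto_of_tendsto hL hR (by
      filter_upwards [self_mem_nhdsWithin, hleft (Ioo_mem_nhds hs.1 hs.2),
        hright (Ioo_mem_nhds hs.1 hs.2)] with r hr h1 h2
      have hr' : s - r ≤ s + r := by have : 0 < r := hr; linarith
      have h3 := h.variational (s - r) (Ioo_subset_Icc_self h1) (s + r)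
        (Ioo_subset_Icc_self h2) hr' z hz
      have h4 : 0 ≤ (A (s + r) - A (s - r))⁻¹ := inv_nonneg.2 (sub_nonneg.2 (hA hr'))
      have h5 := mul_le_mul_of_nonneg_left h3 h4
      rw [real_inner_smul_right]
      refine le_trans (le_of_eq ?_) h5
      rw [div_eq_mul_inv]
      ring)
    rw [mul_zero, add_zero] at hle
    linarith
  have hfr := mem_frontier_of_inner_add_nonneg hD (h.mem_closure s hsI) hn
    fun z hz => key z (subset_closure hz)
  -- A strictly positive constant above `C * κ`, so that `1 / (2 * c)` is a genuine radius.
  set c := |C * κ| + 1 with hc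
  have hc0 : 0 < c := by positivity
  refine ⟨hfr, 1 / (2 * c), by positivity, (mem_normalsOfRadius_iff (by positivity)).2
    ⟨hn, fun z hz => (key z (subset_closure hz)).trans ?_⟩⟩
  have h1 : ‖z - x s‖ ^ 2 / (2 * (1 / (2 * c))) = c * ‖z - x s‖ ^ 2 := by field_simp
  rw [h1]
  have h2 : C * κ ≤ c := by have := le_abs_self (C * κ); linarith
  gcongr

variable [FiniteDimensional ℝ E] [CompleteSpace F]

/-- A solution of the reflecting equation satisfies the increment description, for the control
that adds the total variation of the reflection to that of the driver. -/
theorem IsSolution.isIncrementSolution {hw : BoundedVariationOn w (Icc 0 T)} (hT : 0 ≤ T)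
    (hwc : ContinuousOn w (Icc 0 T)) {r₀ : ℝ} (hr₀ : 0 < r₀)
    (hA : ∀ x ∈ frontier D, normals D x = normalsOfRadius D x r₀)
    {M K : ℝ} (hM : 0 ≤ M) (hK : 0 ≤ K)
    (hσM : ∀ z, ‖σ z‖ ≤ M) (hbM : ∀ z, ‖b z‖ ≤ M)
    (hσ : ∀ y z, ‖σ y - σ z‖ ≤ K * ‖y - z‖) (hb : ∀ y z, ‖b y - b z‖ ≤ K * ‖y - z‖)
    (hσc : Continuous σ) (hbc : Continuous b) (h : IsSolution D σ b hw x₀ x φ) :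
    ∃ C, 0 ≤ C ∧ IsIncrementSolution D σ b (Icc 0 T) w id
      (fun t => driverControl T w t + totalVar T φ t) C x φ := by
  have hsk := h.skorohod
  have hφ := hsk.boundedVariation
  have hφc := hsk.continuousOn_reflection
  have hfin := isFiniteMeasure_totalVarMeasure hφ hT hφc
  set G : ℝ → ℝ := fun t => driverControl T w t + totalVar T φ t with hG
  have hVm := monotone_driverControl hw
  have hAm := totalVar_mono hφ
  have hGm : Monotone G := hVm.add hAm
  have hVG : ∀ s t, s ≤ t → driverControl T w t - driverControl T w s ≤ G t - G s :=
    fun s t hst => by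
      have := hAm hst
      simp only [hG]; linarith
  have hAG : ∀ s t, s ≤ t → totalVar T φ t - totalVar T φ s ≤ G t - G s := fun s t hst => by
    have := hVm hst
    simp only [hG]; linarith
  have hG0 : ∀ s t, s ≤ t → 0 ≤ G t - G s := fun s t hst => sub_nonneg.2 (hGm hst)
  have hφG : ∀ s ∈ Icc 0 T, ∀ t ∈ Icc 0 T, s ≤ t → ‖φ t - φ s‖ ≤ G t - G s :=
    fun s hs t ht hst => (norm_sub_le_totalVar_sub hφ hs.1 hst ht.2).trans (hAG s t hst)
  set Y := drivenPath σ b hw x₀ x with hY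
  have hYG : ∀ s ∈ Icc 0 T, ∀ t ∈ Icc 0 T, s ≤ t → ‖Y t - Y s‖ ≤ M * (G t - G s) := by
    intro s hs t ht hst
    have h1 := norm_drivenPath_sub_le hσc hbc hw hT hwc x₀ h.continuousOn hs.1 hst ht.2
      (A := 0) (v := 0) (ρ := M) (fun r _ => by simpa using hσM (x r))
      (fun r _ => by simpa using hbM (x r))
    simp only [FunLike.coe_zero, Pi.zero_apply, sub_zero, smul_zero] at h1
    exact h1.trans (mul_le_mul_of_nonneg_left (hVG s t hst) hM)
  -- `M` accounts for the driven path and `1` for the reflection.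
  set L := M + 1 with hL
  have hL0 : 0 ≤ L := by positivity
  have hxG : ∀ s ∈ Icc 0 T, ∀ t ∈ Icc 0 T, s ≤ t → ‖x t - x s‖ ≤ L * (G t - G s) := by
    intro s hs t ht hst
    have h1 := hYG s hs t ht hst
    have h2 := hφG s hs t ht hst
    rw [hsk.decomposition t ht, hsk.decomposition s hs]
    calc _ = ‖(Y t - Y s) + (φ t - φ s)‖ := by congr 1; abel
      _ ≤ _ := norm_add_le _ _
      _ ≤ _ := by rw [hL]; linarith
  have hxr : ∀ s ∈ Icc 0 T, ∀ t ∈ Icc 0 T, ∀ r ∈ Icc s t, ‖x r - x s‖ ≤ L * (G t - G s) := by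
    intro s hs t ht r hr
    refine (hxG s hs r ⟨hs.1.trans hr.1, hr.2.trans ht.2⟩ hr.1).trans ?_
    exact mul_le_mul_of_nonneg_left (sub_le_sub_right (hGm hr.2) _) hL0
  obtain ⟨n, hn, hnm, hφn⟩ := hsk.reflection_eq
  have hfr := hsk.ae_mem_frontier hT
  set μ := totalVarMeasure hφ with hμ
  have hnn : ∀ᵐ r ∂μ.restrict (Ioc 0 T), n r ∈ normalsOfRadius D (x r) r₀ := by
    filter_upwards [hfr, ae_restrict_mem measurableSet_Ioc] with r hr hrm
    rw [← hA _ hr]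
    exact hn r (Ioc_subset_Icc_self hrm) hr
  have hni : IntegrableOn n (Ioc 0 T) μ :=
    Integrable.of_bound hnm 1 (hnn.mono fun r hr => hr.1.le)
  have hdφ : ∀ s ∈ Icc 0 T, ∀ t ∈ Icc 0 T, s ≤ t → φ t - φ s = ∫ r in Ioc s t, n r ∂μ := by
    intro s hs t ht hst
    rw [hφn t ht, hφn s hs, ← Ioc_union_Ioc_eq_Ioc hs.1 hst, setIntegral_union
      (Ioc_disjoint_Ioc_of_le le_rfl) measurableSet_Ioc
      (hni.mono_set (Ioc_subset_Ioc le_rfl hs.2)) (hni.mono_set (Ioc_subset_Ioc hs.1 ht.2)),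
      add_sub_cancel_left]
  set C := L + K * L + 1 / (2 * r₀) + L / r₀ + L ^ 2 / (2 * r₀) with hC
  have hC0 : 0 ≤ C := by positivity
  have hLC : L ≤ C := by
    have : 0 ≤ K * L + 1 / (2 * r₀) + L / r₀ + L ^ 2 / (2 * r₀) := by positivity
    linarith
  refine ⟨C, hC0, hsk.mem_closure, fun s hs t ht hst => ?_, fun s hs t ht hst => ?_,
    fun s hs t ht hst => ?_, fun s hs t ht hst z hz => ?_⟩
  · exact (hxG s hs t ht hst).trans (mul_le_mul_of_nonneg_right hLC (hG0 s t hst))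
  · refine (hφG s hs t ht hst).trans (le_mul_of_one_le_left (hG0 s t hst) ?_)
    linarith
  · have h1 := norm_drivenPath_sub_le hσc hbc hw hT hwc x₀ h.continuousOn hs.1 hst ht.2
      (A := σ (x s)) (v := b (x s)) (ρ := K * (L * (G t - G s)))
      (fun r hr => (hσ _ _).trans (mul_le_mul_of_nonneg_left (hxr s hs t ht r hr) hK))
      (fun r hr => (hb _ _).trans (mul_le_mul_of_nonneg_left (hxr s hs t ht r hr) hK))
    have h2 : x t - x s - σ (x s) (w t - w s) - (id t - id s) • b (x s) - (φ t - φ s) =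
        Y t - Y s - σ (x s) (w t - w s) - (t - s) • b (x s) := by
      have e1 : x t = Y t + φ t := hsk.decomposition t ht
      have e2 : x s = Y s + φ s := hsk.decomposition s hs
      have e3 : x t - x s = Y t - Y s + (φ t - φ s) := by rw [e1, e2]; abel
      rw [e3]
      simp only [id]
      abel
    rw [h2]
    have hg := hG0 s t hst
    refine h1.trans ?_
    calc _ ≤ K * (L * (G t - G s)) * (G t - G s) :=
          mul_le_mul_of_nonneg_left (hVG s t hst) (by positivity)
      _ = K * L * (G t - G s) ^ 2 := by ring
      _ ≤ _ := by
        refine mul_le_mul_of_nonneg_right ?_ (by positivity)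
        have : 0 ≤ L + 1 / (2 * r₀) + L / r₀ + L ^ 2 / (2 * r₀) := by positivity
        linarith
  · have hg := hG0 s t hst
    have ha : 0 ≤ ‖z - x s‖ := norm_nonneg _
    set a := ‖z - x s‖ with ha_def
    set δ := G t - G s with hδ
    -- The first term is the proximal error at `x r`; the second is the cost of moving the base
    -- point from `x r` to `x s`, as `‖n r‖ = 1`.
    set B := (a + L * δ) ^ 2 / (2 * r₀) + L * δ with hB
    have hB0 : 0 ≤ B := by positivity
    have hsub : Ioc s t ⊆ Ioc 0 T := Ioc_subset_Ioc hs.1 ht.2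
    have hnist : IntegrableOn n (Ioc s t) μ := hni.mono_set hsub
    have hpt : ∀ᵐ r ∂μ.restrict (Ioc s t), -B ≤ inner ℝ (z - x s) (n r) := by
      filter_upwards [ae_restrict_of_ae_restrict_of_subset hsub hnn,
        ae_restrict_mem measurableSet_Ioc] with r hr hrm
      have k1 := inner_add_nonneg_of_mem_normalsOfRadius hr₀ hr hz
      have k2 := hxr s hs t ht r (Ioc_subset_Icc_self hrm)
      have k3 : ‖z - x r‖ ≤ a + L * δ := by
        calc ‖z - x r‖ = ‖(z - x s) - (x r - x s)‖ := by congr 1; abel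
          _ ≤ _ := norm_sub_le _ _
          _ ≤ _ := by linarith
      have k4 : ‖z - x r‖ ^ 2 / (2 * r₀) ≤ (a + L * δ) ^ 2 / (2 * r₀) := by gcongr
      have k5 : -(L * δ) ≤ inner ℝ (x r - x s) (n r) := by
        have k6 := neg_abs_le (inner ℝ (x r - x s) (n r))
        have k7 := abs_real_inner_le_norm (x r - x s) (n r)
        rw [hr.1, mul_one] at k7
        linarith
      have k8 : inner ℝ (z - x s) (n r) = inner ℝ (z - x r) (n r) + inner ℝ (x r - x s) (n r) := by
        rw [← inner_add_left, sub_add_sub_cancel]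
      rw [k8, hB]
      linarith
    have hmass : μ.real (Ioc s t) ≤ δ := by
      rw [measureReal_def, hμ, totalVarMeasure_Ioc hφ hT hφc,
        ENNReal.toReal_ofReal (sub_nonneg.2 (hAm hst))]
      exact hAG s t hst
    have hmain : -(B * δ) ≤ inner ℝ (z - x s) (φ t - φ s) := by
      rw [hdφ s hs t ht hst, ← integral_inner hnist]
      have k1 : ∫ _ in Ioc s t, -B ∂μ ≤ ∫ r in Ioc s t, inner ℝ (z - x s) (n r) ∂μ :=
        integral_mono_ae (integrable_const _) (hnist.const_inner _) hpt
      rw [setIntegral_const, smul_eq_mul] at k1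
      have k2 : μ.real (Ioc s t) * B ≤ δ * B := mul_le_mul_of_nonneg_right hmass hB0
      linarith
    refine le_trans (neg_le_neg ?_) hmain
    refine mul_le_mul_of_nonneg_right ?_ hg
    have e1 : B = 1 / (2 * r₀) * a ^ 2 + (L + L / r₀ * a + L ^ 2 / (2 * r₀) * δ) * δ := by
      rw [hB]; field_simp; ring
    have c1 : 1 / (2 * r₀) ≤ C := by
      have : 0 ≤ L + K * L + L / r₀ + L ^ 2 / (2 * r₀) := by positivity
      linarith
    have c2 : L / r₀ ≤ C := by
      have : 0 ≤ L + K * L + 1 / (2 * r₀) + L ^ 2 / (2 * r₀) := by positivity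
      linarith
    have c3 : L ^ 2 / (2 * r₀) ≤ C := by
      have : 0 ≤ L + K * L + 1 / (2 * r₀) + L / r₀ := by positivity
      linarith
    rw [e1]
    calc _ ≤ C * a ^ 2 + (C + C * a + C * δ) * δ := by gcongr
      _ = _ := by ring

/-- An increment solution controlled by the driver is a solution of the reflecting equation. -/
theorem IsIncrementSolution.isSolution (hw : BoundedVariationOn w (Icc 0 T)) (hT : 0 ≤ T)
    (hwc : ContinuousOn w (Icc 0 T)) (hD : IsOpen D)
    (hne : ∀ x ∈ frontier D, (normals D x).Nonempty)
    {K : ℝ} (hK : 0 ≤ K)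
    (hσ : ∀ y z, ‖σ y - σ z‖ ≤ K * ‖y - z‖) (hb : ∀ y z, ‖b y - b z‖ ≤ K * ‖y - z‖)
    (hσc : Continuous σ) (hbc : Continuous b) {C : ℝ} (hC : 0 ≤ C)
    (h : IsIncrementSolution D σ b (Icc 0 T) w id (driverControl T w) C x φ)
    (hx0 : x 0 = x₀) (hφ0 : φ 0 = 0) : IsSolution D σ b hw x₀ x φ := by
  have hV := continuous_driverControl hw hT hwc
  have hVm := monotone_driverControl hw
  have hxc : ContinuousOn x (Icc 0 T) := continuousOn_of_norm_sub_le hV.continuousOn h.path_le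
  have hφc : ContinuousOn φ (Icc 0 T) := continuousOn_of_norm_sub_le hV.continuousOn h.reflection_le
  have hxb : BoundedVariationOn x (Icc 0 T) := boundedVariationOn_of_norm_sub_le hT h.path_le
  have hφb : BoundedVariationOn φ (Icc 0 T) := boundedVariationOn_of_norm_sub_le hT h.reflection_le
  set V := driverControl T w with hVdef
  set Y := drivenPath σ b hw x₀ x with hY
  have hY0 : Y 0 = x₀ := drivenPath_zero σ b hw x₀ x
  have hdec : ∀ t ∈ Icc 0 T, x t = Y t + φ t := by
    intro t ht
    have hsub : Icc 0 t ⊆ Icc 0 T := Icc_subset_Icc_right ht.2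
    -- Over each interval both `x - φ` and `Y` agree, up to a quadratic error, with the same
    -- frozen-coefficient increment, so their difference is constant.
    have hconst := eq_of_norm_sub_le_sq (R := fun t => x t - φ t - Y t) (C := C + K * C) ht.1
      (by positivity) (hV.continuousOn (s := Icc 0 t)) (hVm.monotoneOn _) (by
        intro s hs r hr hsr
        have hs' := hsub hs
        have hr' := hsub hr
        have hosc : ∀ q ∈ Icc s r, ‖x q - x s‖ ≤ C * (V r - V s) := fun q hq =>
          (h.path_le s hs' q ⟨hs'.1.trans hq.1, hq.2.trans hr'.2⟩ hq.1).trans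
            (mul_le_mul_of_nonneg_left (sub_le_sub_right (hVm hq.2) _) hC)
        have h1 := norm_drivenPath_sub_le hσc hbc hw hT hwc x₀ hxc hs'.1 hsr hr'.2
          (A := σ (x s)) (v := b (x s)) (ρ := K * (C * (V r - V s)))
          (fun q hq => (hσ _ _).trans (mul_le_mul_of_nonneg_left (hosc q hq) hK))
          (fun q hq => (hb _ _).trans (mul_le_mul_of_nonneg_left (hosc q hq) hK))
        have h2 := h.equation s hs' r hr' hsr
        calc _ = ‖(x r - x s - σ (x s) (w r - w s) - (id r - id s) • b (x s) - (φ r - φ s)) -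
              (Y r - Y s - σ (x s) (w r - w s) - (r - s) • b (x s))‖ := by
              congr 1; simp only [id]; abel
          _ ≤ _ := norm_sub_le _ _
          _ ≤ C * (V r - V s) ^ 2 + K * (C * (V r - V s)) * (V r - V s) := add_le_add h2 h1
          _ = _ := by ring)
    simp only [hx0, hφ0, hY0, sub_zero, sub_self] at hconst
    rw [← sub_eq_zero, ← hconst]
    abel
  obtain ⟨n, hnm, hnφ, hnae⟩ := exists_polar_density hT hφb hφc
  have hAm := totalVar_mono hφb
  have hAc := continuous_totalVar hφb hT hφc
  have hfin := isFiniteMeasure_totalVarMeasure hφb hT hφc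
  have hatoms : NullSingletonClass (totalVarMeasure hφb) :=
    noAtoms_stieltjesFunction_measure hAm hAc
  have hgood : ∀ᵐ s ∂(totalVarMeasure hφb).restrict (Ioc 0 T),
      x s ∈ frontier D ∧ n s ∈ normals D (x s) := by
    -- The driver control may be singular with respect to `d‖φ‖`; only a finite limit of slopes is
    -- needed.
    have hslope : ∀ᵐ s ∂totalVarMeasure hφb, _ := ae_tendsto_slope_stieltjes hAm hAc hVm hV
    -- Symmetric slopes need room on both sides; the endpoint is discarded because the measure has
    -- no atoms.
    have hTne : ∀ᵐ s ∂totalVarMeasure hφb, s ≠ T := by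
      rw [ae_iff]; simp
    filter_upwards [hnae, ae_restrict_of_ae hslope, ae_restrict_of_ae hTne,
      ae_restrict_mem measurableSet_Ioc] with s h1 h2 h3 h4
    have hs : s ∈ Ioo 0 T := ⟨h4.1, lt_of_le_of_ne h4.2 h3⟩
    refine h.mem_frontier_and_mem_normals hD hAm hV hxc hs h1.1 (h1.2.congr' ?_) h2
    have hleft : Tendsto (fun r : ℝ => s - r) (𝓝[>] 0) (𝓝 s) := by
      have : Continuous fun r : ℝ => s - r := by fun_prop
      simpa using (this.tendsto 0).mono_left nhdsWithin_le_nhds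
    have hright : Tendsto (fun r : ℝ => s + r) (𝓝[>] 0) (𝓝 s) := by
      have : Continuous fun r : ℝ => s + r := by fun_prop
      simpa using (this.tendsto 0).mono_left nhdsWithin_le_nhds
    filter_upwards [hleft (Ioo_mem_nhds hs.1 hs.2), hright (Ioo_mem_nhds hs.1 hs.2)] with r k1 k2
    rw [clamp_of_mem (Ioo_subset_Icc_self k1), clamp_of_mem (Ioo_subset_Icc_self k2)]
  refine ⟨hxc, hxb, ⟨hxc, h.mem_closure, hx0.trans hY0.symm, hdec, hφc, hφ0, hφb, ?_, ?_⟩⟩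
  · classical
    choose! N hN using hne
    -- The Skorohod problem asks for a normal at every frontier time, so `n` is altered on a null
    -- set by an arbitrary choice of normals.
    set n' : ℝ → E := fun s => if n s ∈ normals D (x s) then n s else N (x s) with hn'
    have hae : n =ᵐ[(totalVarMeasure hφb).restrict (Ioc 0 T)] n' := by
      filter_upwards [hgood] with s hs
      simp only [hn', if_pos hs.2]
    refine ⟨n', fun s _ hfr => ?_, hnm.aestronglyMeasurable.congr hae, fun t ht => ?_⟩
    · by_cases hns : n s ∈ normals D (x s)
      · simpa only [hn', if_pos hns] using hns
      · simpa only [hn', if_neg hns] using hN (x s) hfr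
    · have := hnφ t ht
      rw [hφ0, sub_zero] at this
      rw [this]
      exact integral_congr_ae
        (ae_restrict_of_ae_restrict_of_subset (Ioc_subset_Ioc le_rfl ht.2) hae)
  · intro t ht
    have h1 : ∫ s in Ioc 0 t, (frontier D).indicator (fun _ => (1 : ℝ)) (x s)
        ∂totalVarMeasure hφb = ∫ _ in Ioc 0 t, (1 : ℝ) ∂totalVarMeasure hφb := by
      refine integral_congr_ae (ae_restrict_of_ae_restrict_of_subset
        (Ioc_subset_Ioc le_rfl ht.2) ?_)
      filter_upwards [hgood] with s hs
      simp [hs.1]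
    rw [h1, setIntegral_const, smul_eq_mul, mul_one, measureReal_def,
      totalVarMeasure_Ioc hφb hT hφc, totalVar_zero, sub_zero,
      ENNReal.toReal_ofReal (show 0 ≤ totalVar T φ t from ENNReal.toReal_nonneg)]

/-- The scheme runs on `[0, ∞)` with the clamped driver; this restores the original one on `[0, T]`.
-/
theorem IsIncrementSolution.congr_driver {E F ι : Type*} [Preorder ι] [NormedAddCommGroup E]
    [InnerProductSpace ℝ E] [NormedAddCommGroup F] [NormedSpace ℝ F] {D : Set E}
    {σ : E → F →L[ℝ] E} {b : E → E} {S : Set ι} {w w' : ι → F} {τ G : ι → ℝ} {C : ℝ}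
    {x φ : ι → E} (h : IsIncrementSolution D σ b S w τ G C x φ) (hww' : EqOn w w' S) :
    IsIncrementSolution D σ b S w' τ G C x φ where
  mem_closure := h.mem_closure
  path_le := h.path_le
  reflection_le := h.reflection_le
  equation s hs t ht hst := by
    rw [← hww' hs, ← hww' ht]
    exact h.equation s hs t ht hst
  variational := h.variational

/-- Existence and uniqueness for the reflecting equation under the uniform exterior sphere
condition. -/
theorem exists_unique_isSolution (hD : IsOpen D) (hA : ConditionA D)
    (hσM : ∃ M : ℝ, ∀ z, ‖σ z‖ ≤ M) (hσL : ∃ K : ℝ≥0, LipschitzWith K σ)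
    (hbM : ∃ M : ℝ, ∀ z, ‖b z‖ ≤ M) (hbL : ∃ K : ℝ≥0, LipschitzWith K b)
    (hT : 0 ≤ T) (hwc : ContinuousOn w (Icc 0 T)) (hw : BoundedVariationOn w (Icc 0 T))
    (hx₀ : x₀ ∈ closure D) :
    ∃ x φ : ℝ → E, IsSolution D σ b hw x₀ x φ ∧ ∀ x' φ' : ℝ → E,
      IsSolution D σ b hw x₀ x' φ' → EqOn x' x (Icc 0 T) ∧ EqOn φ' φ (Icc 0 T) := by
  obtain ⟨r₀, hr₀, hAr⟩ := hA
  have hAeq : ∀ x ∈ frontier D, normals D x = normalsOfRadius D x r₀ := fun x hx => (hAr x hx).1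
  obtain ⟨Kσ, hσ⟩ := hσL
  obtain ⟨Kb, hb⟩ := hbL
  obtain ⟨C, hC, x, φ, hx0, hφ0, hinc⟩ := exists_isIncrementSolution hD hr₀ hAeq hσM hbM hσ hb hx₀
    (continuous_clamp hT hwc) (continuous_driverControl hw hT hwc)
    (norm_clamp_sub_add_le_driverControl hw hT)
  obtain ⟨M₁, hM₁⟩ := hσM
  obtain ⟨M₂, hM₂⟩ := hbM
  have hM₁0 : 0 ≤ M₁ := (norm_nonneg _).trans (hM₁ 0)
  have hM₂0 : 0 ≤ M₂ := (norm_nonneg _).trans (hM₂ 0)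
  have hK : ∀ y z, ‖σ y - σ z‖ ≤ (Kσ + Kb : ℝ) * ‖y - z‖ := fun y z =>
    (hσ.norm_sub_le y z).trans (by gcongr; simp)
  have hK' : ∀ y z, ‖b y - b z‖ ≤ (Kσ + Kb : ℝ) * ‖y - z‖ := fun y z =>
    (hb.norm_sub_le y z).trans (by gcongr; simp)
  have hincT : IsIncrementSolution D σ b (Icc 0 T) w id (driverControl T w) C x φ :=
    (hinc.comp monotone_id fun t ht => ht.1).congr_driver fun t ht => clamp_of_mem ht
  have hsol : IsSolution D σ b hw x₀ x φ := hincT.isSolution hw hT hwc hD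
    (fun x hx => (hAr x hx).2) (by positivity) hK hK' hσ.continuous hb.continuous hC hx0 hφ0
  refine ⟨x, φ, hsol, fun x' φ' hsol' => ?_⟩
  obtain ⟨C', hC', hinc'⟩ := hsol'.isIncrementSolution hT hwc hr₀ hAeq (M := M₁ + M₂)
    (by positivity) (by positivity) (fun z => (hM₁ z).trans (by linarith))
    (fun z => (hM₂ z).trans (by linarith)) hK hK' hσ.continuous hb.continuous
  have hV := continuous_driverControl hw hT hwc
  have hVm := monotone_driverControl hw
  have hx0' : x' 0 = x₀ := hsol'.skorohod.initial.trans (drivenPath_zero σ b hw x₀ x')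
  have heq : EqOn x x' (Icc 0 T) := by
    refine IsIncrementSolution.eqOn hσ hb hC hC' hV.continuousOn (hVm.monotoneOn _)
      (hV.continuousOn.add (continuousOn_totalVar hsol'.skorohod.boundedVariation
        hsol'.skorohod.continuousOn_reflection))
      ((hVm.add (totalVar_mono hsol'.skorohod.boundedVariation)).monotoneOn _)
      (fun s hs t ht hst => ?_) (fun s hs t ht hst => ?_) hincT hinc' (hx0.trans hx0'.symm)
    · have := norm_sub_add_le_driverControl hw hs ht hst
      linarith
    · have := norm_sub_add_le_driverControl hw hs ht hst
      have := norm_nonneg (w t - w s)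
      linarith
  refine ⟨heq.symm, fun t ht => ?_⟩
  have h1 := hsol.skorohod.decomposition t ht
  have h2 := hsol'.skorohod.decomposition t ht
  -- Equal paths have equal driven paths, so the reflections agree by subtraction.
  rw [← heq ht, ← drivenPath_congr hw heq ht, h1] at h2
  exact (add_left_cancel h2).symm

end Equivalence

end ReflectingODE

theorem mainTheorem7 {d n : ℕ} (D : Set (EuclideanSpace ℝ (Fin d)))
    (hD_open : IsOpen D) (hD_conn : IsConnected D)
    (hA : ReflectingODE.ConditionA D) (hB : ReflectingODE.ConditionB D)
    (σ : EuclideanSpace ℝ (Fin d) → EuclideanSpace ℝ (Fin n) →L[ℝ] EuclideanSpace ℝ (Fin d))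
    (b : EuclideanSpace ℝ (Fin d) → EuclideanSpace ℝ (Fin d))
    (hσ_bdd : ∃ C : ℝ, ∀ z, ‖σ z‖ ≤ C) (hσ_lip : ∃ K : ℝ≥0, LipschitzWith K σ)
    (hb_bdd : ∃ C : ℝ, ∀ z, ‖b z‖ ≤ C) (hb_lip : ∃ K : ℝ≥0, LipschitzWith K b)
    (T : ℝ) (hT : 0 ≤ T) (w : ℝ → EuclideanSpace ℝ (Fin n))
    (hw_cont : ContinuousOn w (Set.Icc 0 T)) (hw : BoundedVariationOn w (Set.Icc 0 T))
    (x₀ : EuclideanSpace ℝ (Fin d)) (hx₀ : x₀ ∈ closure D) :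
    ∃ x Φ : ℝ → EuclideanSpace ℝ (Fin d),
      ReflectingODE.IsSolution D σ b hw x₀ x Φ ∧
      ∀ x' Φ' : ℝ → EuclideanSpace ℝ (Fin d), ReflectingODE.IsSolution D σ b hw x₀ x' Φ' →
        Set.EqOn x' x (Set.Icc 0 T) ∧ Set.EqOn Φ' Φ (Set.Icc 0 T) :=
  ReflectingODE.exists_unique_isSolution hD_open hA hσ_bdd hσ_lip hb_bdd hb_lip hT hw_cont hw hx₀
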